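/- Let $n\ge 2$ and let $\mathcal M^n$ be Euclidean space $\mathbb R^n$, the unit sphere $S^n\subset\mathbb R^{n+1}$, or hyperbolic space $H^n$ (of curvature $-1$), with geodesic distance $d$ and closed balls $B(z,r)=\{x : d(x,z)\le r\}$. For a bounded set $X\subset\mathcal M^n$ let $\operatorname{diam}X=\sup_{x,y\in X}d(x,y)$. A bounded set $K\subset\mathcal M^n$ is called complete if $\operatorname{diam}(K\cup\{y\})>\operatorname{diam}K$ for every $y\in\mathcal M^n\setminus K$. Write $$r(K)=\max\{r\ge 0 : B(z,r)\subseteq K\text{ for some }z\in\mathcal M^n\},\qquad R(K)=\min\{R\ge 0 : K\subseteq B(z,R)\text{ for some }z\in\mathcal M^n\}.$$ Let $D>0$, with $D<\pi/2$ if $\mathcal M^n=S^n$. Then $\mathcal M^n$ contains a regular $n$-dimensional simplex $\Delta(D)$ of edge length $D$, that is, the geodesic convex hull of $n+1$ points whose mutual distances are all $D$. Let $\Delta(D)$ be any such simplex, and let $K\subset\mathcal M^n$ be a complete set of diameter $D$. Then the extrema defining $R(K)$, $r(K)$ and $R(\Delta(D))$ are attained, $$R(K)\le R(\Delta(D))\qquad\text{and}\qquad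 r(K)\ge D-R(\Delta(D)).$$ Moreover, $R(K)=R(\Delta(D))$ if and only if $K$ contains a congruent copy of $\Delta(D)$ (its image under an isometry of $\mathcal M^n$), and $r(K)=D-R(\Delta(D))$ if and only if $K$ contains a congruent copy of $\Delta(D)$. -/

import Mathlib

namespace ConstCurv

/-- The three kinds of spaces of constant curvature. -/
inductive Kind : Type
  | euclidean
  | spherical
  | hyperbolic

/-- Euclidean space `ℝⁿ`. -/
abbrev Euc (n : ℕ) : Type := EuclideanSpace ℝ (Fin n)

/-- The unit sphere `Sⁿ` of `ℝⁿ⁺¹`. -/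
abbrev Sph (n : ℕ) : Type := Metric.sphere (0 : Euc (n + 1)) 1

/-- The bilinear form `B(x, y) = t s - ⟨x₀, y₀⟩` of `ℝⁿ⁺¹`, where `x = x₀ + t e`,
`y = y₀ + s e` and `x₀, y₀ ⊥ e`; here `e` is the standard unit vector of index `0`. -/
def lorentz {n : ℕ} (x y : Euc (n + 1)) : ℝ :=
  x 0 * y 0 - ∑ i : Fin n, x i.succ * y i.succ

/-- Hyperbolic space `Hⁿ`: the sheet `{x | x 0 ≥ 1, B(x, x) = 1}` of the hyperboloid. -/
abbrev Hyp (n : ℕ) : Type := {x : Euc (n + 1) // 1 ≤ x 0 ∧ lorentz x x = 1}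

/-- The geodesic distance of `Sⁿ`. -/
noncomputable def sphDist {n : ℕ} (x y : Sph n) : ℝ :=
  2 * Real.arcsin (dist (x : Euc (n + 1)) (y : Euc (n + 1)) / 2)

/-- The geodesic distance of `Hⁿ`. -/
noncomputable def hypDist {n : ℕ} (x y : Hyp n) : ℝ :=
  Real.arcosh (lorentz (x : Euc (n + 1)) (y : Euc (n + 1)))

/-- The segment `[x, y]` of `ℝⁿ`: the points `x + s u`, `0 ≤ s ≤ t`, where `u` is a unit vector
with `y = x + t u`. -/
def eucSegment {n : ℕ} (x y : Euc n) : Set (Euc n) :=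
  {z | ∃ (u : Euc n) (t s : ℝ), ‖u‖ = 1 ∧ 0 ≤ s ∧ s ≤ t ∧
    y = x + t • u ∧ z = x + s • u}

/-- The geodesic segment `[x, y]` of `Sⁿ` (for `y ≠ -x`): the points `(cos s) x + (sin s) u`,
`0 ≤ s ≤ t`, where `u` is a unit tangent vector at `x` and `t < π` satisfies
`y = (cos t) x + (sin t) u`. -/
def sphSegment {n : ℕ} (x y : Sph n) : Set (Sph n) :=
  {z | ∃ (u : Euc (n + 1)) (t s : ℝ), inner ℝ u (x : Euc (n + 1)) = 0 ∧ ‖u‖ = 1 ∧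
    0 ≤ s ∧ s ≤ t ∧ t < Real.pi ∧
    (y : Euc (n + 1)) = Real.cos t • (x : Euc (n + 1)) + Real.sin t • u ∧
    (z : Euc (n + 1)) = Real.cos s • (x : Euc (n + 1)) + Real.sin s • u}

/-- The geodesic segment `[x, y]` of `Hⁿ`: the points `(cosh s) x + (sinh s) u`, `0 ≤ s ≤ t`,
where `u` is a unit tangent vector at `x` (that is, `B(x, u) = 0` and `-B(u, u) = 1`) with
`y = (cosh t) x + (sinh t) u`. -/
def hypSegment {n : ℕ} (x y : Hyp n) : Set (Hyp n) :=
  {z | ∃ (u : Euc (n + 1)) (t s : ℝ), lorentz (x : Euc (n + 1)) u = 0 ∧ -lorentz u u = 1 ∧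
    0 ≤ s ∧ s ≤ t ∧
    (y : Euc (n + 1)) = Real.cosh t • (x : Euc (n + 1)) + Real.sinh t • u ∧
    (z : Euc (n + 1)) = Real.cosh s • (x : Euc (n + 1)) + Real.sinh s • u}

/-- The space `Mⁿ` of the given kind: `ℝⁿ`, `Sⁿ` or `Hⁿ`. -/
def Space : Kind → ℕ → Type
  | .euclidean, n => Euc n
  | .spherical, n => Sph n
  | .hyperbolic, n => Hyp n

/-- The geodesic distance of `Mⁿ`. -/
noncomputable def gdist : {k : Kind} → {n : ℕ} → Space k n → Space k n → ℝ
  | .euclidean, n => fun x y => dist (α := Euc n) x y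
  | .spherical, n => sphDist (n := n)
  | .hyperbolic, n => hypDist (n := n)

/-- The geodesic segment `[x, y]` of `Mⁿ`. -/
def geodSegment : {k : Kind} → {n : ℕ} → Space k n → Space k n → Set (Space k n)
  | .euclidean, n => eucSegment (n := n)
  | .spherical, n => sphSegment (n := n)
  | .hyperbolic, n => hypSegment (n := n)

/-- In the case of `Sⁿ`: the set `X` is contained in an open hemisphere. In the cases of `ℝⁿ` and
`Hⁿ` there is no condition. -/
def HemisphereCondition : {k : Kind} → {n : ℕ} → Set (Space k n) → Prop
  | .euclidean, _ => fun _ => True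
  | .spherical, n => fun (X : Set (Sph n)) =>
      ∃ w : Sph n, ∀ x ∈ X, 0 < inner ℝ (w : Euc (n + 1)) (x : Euc (n + 1))
  | .hyperbolic, _ => fun _ => True

variable {k : Kind} {n : ℕ}

/-- Geodesic convexity in `Mⁿ`. -/
def IsConvex (X : Set (Space k n)) : Prop :=
  HemisphereCondition X ∧ ∀ x ∈ X, ∀ y ∈ X, geodSegment x y ⊆ X

/-- The convex hull: the intersection of all convex sets containing `Z`. -/
def hull (Z : Set (Space k n)) : Set (Space k n) :=
  ⋂₀ {C | IsConvex C ∧ Z ⊆ C}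

/-- The closed ball `B(z, r)` of `Mⁿ`. -/
def ball (z : Space k n) (r : ℝ) : Set (Space k n) :=
  {x | gdist x z ≤ r}

/-- The distances between two points of `X`. -/
def distances (X : Set (Space k n)) : Set ℝ :=
  {a | ∃ x ∈ X, ∃ y ∈ X, a = gdist x y}

/-- The diameter of a bounded set: the supremum of the distances of its points. -/
noncomputable def diam (X : Set (Space k n)) : ℝ :=
  sSup (distances X)

/-- A bounded set `K` is complete if adding any further point increases its diameter. -/
def DiamComplete (K : Set (Space k n)) : Prop :=
  BddAbove (distances K) ∧ ∀ y, y ∉ K → diam K < diam (insert y K)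

/-- The radii `r ≥ 0` of the balls contained in `K`. -/
def innerRadii (K : Set (Space k n)) : Set ℝ :=
  {r | 0 ≤ r ∧ ∃ z, ball z r ⊆ K}

/-- The radii `R ≥ 0` of the balls containing `K`. -/
def outerRadii (K : Set (Space k n)) : Set ℝ :=
  {R | 0 ≤ R ∧ ∃ z, K ⊆ ball z R}

/-- The inradius `r(K)`. -/
noncomputable def inradius (K : Set (Space k n)) : ℝ :=
  sSup (innerRadii K)

/-- The circumradius `R(K)`. -/
noncomputable def circumradius (K : Set (Space k n)) : ℝ :=
  sInf (outerRadii K)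

/-- `S` is a regular `n`-dimensional simplex of edge length `D` in `Mⁿ`: the convex hull of `n + 1`
points whose mutual distances are all `D`. For `D > 0` (and `D < π / 2` in `Sⁿ`) such points are
automatically in general position. -/
def IsRegularSimplex (D : ℝ) (S : Set (Space k n)) : Prop :=
  ∃ v : Fin (n + 1) → Space k n,
    (∀ i j, i ≠ j → gdist (v i) (v j) = D) ∧ S = hull (Set.range v)

/-- `K` contains a congruent copy of `S`, that is, the image of `S` under an isometry of `Mⁿ`. -/
def ContainsCongruentCopy (K S : Set (Space k n)) : Prop :=
  ∃ φ : Space k n ≃ Space k n,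
    (∀ x y, gdist (φ x) (φ y) = gdist x y) ∧ φ '' S ⊆ K

end ConstCurv

open ConstCurv

namespace ConstCurv

/-! Distance is replaced by an increasing function `A` of it that averages well: the squared
distance in `ℝⁿ`, `1 - cos d` in `Sⁿ`, `cosh d - 1` in `Hⁿ`. For points `p i` with weights `l i` of
sum 1, the barycentre (normalised in the curved cases) ties the energy to circumradii. Every `x`
whose potential is at most the energy lies within `rad (energy A l p)` of it (`exists_center`), and
no ball containing all `p i` has smaller radius (`rad_le`).

Maximise the energy over all weights and points in a compact `K`. First order optimality gives
potential at most energy on all of `K`, so `R(K)` is exactly `rad` of the maximum. A linear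
dependence among `n + 2` points lets one weight be removed, so `n + 1` points suffice
(`exists_optimal`). For these, `energy_gap` writes `H * (n / (n + 1))` minus the energy as a sum of
nonnegative terms, which all vanish only for equal weights and mutual distances `D`. This is Jung's
inequality with its equality case (`jung`); the bound is the circumradius of the regular simplex.

A complete set is the intersection of the balls of radius `D` about its points, and this gives `r(K)
+ R(K) = D` (`isGreatest_sub_circumradius`). So the claims on the inradius are those on the
circumradius. Finally, reflections carry any regular simplex to any other of the same edge length
(`exists_isometry`), and a complete set containing the vertices contains the hull
(`containsCongruentCopy`).

`JungSpace` collects what this argument needs from the geometry; it is verified separately in the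
three spaces. -/

/-- The weighted sum `∑ i, l i * A (p i) x`. -/
def potential {X : Type*} (A : X → X → ℝ) {m : ℕ} (l : Fin m → ℝ) (p : Fin m → X) (x : X) : ℝ :=
  ∑ i, l i * A (p i) x

/-- The energy `∑ i j, l i * l j * A (p i) (p j)` of a weighted family of points. -/
def energy {X : Type*} (A : X → X → ℝ) {m : ℕ} (l : Fin m → ℝ) (p : Fin m → X) : ℝ :=
  ∑ j, l j * potential A l p (p j)

/-- The metric facts about `Mⁿ` behind Jung's theorem for sets of diameter `D`. The function `A` is
an increasing function of the distance whose energy controls circumradii by way of `rad`, and `H` is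
its value at distance `D`. -/
structure JungSpace (k : Kind) (n : ℕ) [TopologicalSpace (Space k n)] (D H : ℝ)
    (A : Space k n → Space k n → ℝ) (rad : ℝ → ℝ) : Prop where
  D_pos : 0 < D
  H_pos : 0 < H
  dist_self : ∀ x : Space k n, gdist x x = 0
  dist_comm : ∀ x y : Space k n, gdist x y = gdist y x
  dist_triangle : ∀ x y z : Space k n, gdist x z ≤ gdist x y + gdist y z
  continuous_chord : Continuous fun q : Space k n × Space k n => A q.1 q.2
  chord_comm : ∀ x y, A x y = A y x
  chord_self : ∀ x, A x x = 0
  chord_nonneg : ∀ x y, 0 ≤ A x y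
  chord_le_iff : ∀ x y, A x y ≤ H ↔ gdist x y ≤ D
  dist_eq_of_chord_eq : ∀ x y, A x y = H → gdist x y = D
  chord_eq_of_dist_eq : ∀ x y, gdist x y = D → A x y = H
  isCompact_ball : ∀ z : Space k n, IsCompact (ball z D)
  rad_nonneg : ∀ e, 0 ≤ e → 0 ≤ rad e
  rad_strictMono : StrictMonoOn rad (Set.Icc 0 H)
  exists_center : ∀ (m : ℕ) (l : Fin m → ℝ) (p : Fin m → Space k n), l ∈ stdSimplex ℝ (Fin m) →
    (∀ i j, A (p i) (p j) ≤ H) →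
    ∃ z, ∀ x, potential A l p x ≤ energy A l p → gdist x z ≤ rad (energy A l p)
  rad_le : ∀ (m : ℕ) (l : Fin m → ℝ) (p : Fin m → Space k n), l ∈ stdSimplex ℝ (Fin m) →
    (∀ i j, A (p i) (p j) ≤ H) →
    ∀ z R, (∀ i, gdist (p i) z ≤ R) → rad (energy A l p) ≤ R
  exists_dependence : ∀ (l : Fin (n + 2) → ℝ) (p : Fin (n + 2) → Space k n),
    l ∈ stdSimplex ℝ (Fin (n + 2)) → (∀ i j, A (p i) (p j) ≤ H) →
    (∀ j, potential A l p (p j) = energy A l p) →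
    ∃ a : Fin (n + 2) → ℝ, a ≠ 0 ∧ ∑ i, a i = 0 ∧ ∀ j, potential A a p (p j) = 0
  exists_extension : ∀ (x z : Space k n) (r : ℝ), 0 ≤ r → r ≤ D → x ≠ z → gdist x z ≤ D →
    ∃ y, gdist y z ≤ r ∧ gdist x z + r ≤ gdist x y
  exists_reflection : ∀ x y : Space k n, x ≠ y → ∃ σ : Space k n ≃ Space k n,
    (∀ a b, gdist (σ a) (σ b) = gdist a b) ∧ σ x = y ∧ ∀ z, gdist z x = gdist z y → σ z = z
  hemisphereCondition : ∀ (z : Space k n) (X : Set (Space k n)), X ⊆ ball z D →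
    HemisphereCondition X
  geodSegment_subset : ∀ (z : Space k n) (R : ℝ), R ≤ D → ∀ x ∈ ball z R, ∀ y ∈ ball z R,
    geodSegment x y ⊆ ball z R
  exists_simplex : ∃ v : Fin (n + 1) → Space k n, ∀ i j, i ≠ j → gdist (v i) (v j) = D

/-! ### Energies of weighted point families: optimality conditions and the sharp upper bound -/

section Energy

variable {X : Type*} {A : X → X → ℝ} {m : ℕ}

lemma energy_eq_sum (l : Fin m → ℝ) (p : Fin m → X) :
    energy A l p = ∑ j, ∑ i, l j * l i * A (p i) (p j) := by
  simp only [energy, potential, Finset.mul_sum, mul_assoc]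

lemma energy_nonneg (hA : ∀ x y, 0 ≤ A x y) {l : Fin m → ℝ} (hl : ∀ i, 0 ≤ l i) (p : Fin m → X) :
    0 ≤ energy A l p :=
  Finset.sum_nonneg fun j _ => mul_nonneg (hl j) <|
    Finset.sum_nonneg fun i _ => mul_nonneg (hl i) (hA _ _)

lemma potential_add_smul (l a : Fin m → ℝ) (t : ℝ) (p : Fin m → X) (x : X) :
    potential A (l + t • a) p x = potential A l p x + t * potential A a p x := by
  simp only [potential, Finset.mul_sum, ← Finset.sum_add_distrib]
  exact Finset.sum_congr rfl fun i _ => by simp; ring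

lemma sum_mul_potential_comm (hA : ∀ x y, A x y = A y x) (l a : Fin m → ℝ) (p : Fin m → X) :
    ∑ j, a j * potential A l p (p j) = ∑ j, l j * potential A a p (p j) := by
  simp only [potential, Finset.mul_sum]
  rw [Finset.sum_comm]
  exact Finset.sum_congr rfl fun i _ => Finset.sum_congr rfl fun j _ => by
    rw [hA (p i) (p j)]; ring

lemma energy_add_smul (hA : ∀ x y, A x y = A y x) (l a : Fin m → ℝ) (t : ℝ) (p : Fin m → X) :
    energy A (l + t • a) p = energy A l p + 2 * t * ∑ j, a j * potential A l p (p j)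
      + t ^ 2 * energy A a p := by
  have h : energy A (l + t • a) p = ∑ j, (l j * potential A l p (p j)
      + t * (l j * potential A a p (p j)) + t * (a j * potential A l p (p j))
      + t ^ 2 * (a j * potential A a p (p j))) := by
    refine Finset.sum_congr rfl fun j _ => ?_
    rw [potential_add_smul]
    simp only [Pi.add_apply, Pi.smul_apply, smul_eq_mul]
    ring
  rw [h]
  simp only [Finset.sum_add_distrib, ← Finset.mul_sum]
  rw [← sum_mul_potential_comm hA l a p]
  simp only [energy]
  ring

lemma potential_succAbove {l : Fin (m + 1) → ℝ} {k : Fin (m + 1)} (hk : l k = 0)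
    (p : Fin (m + 1) → X) (x : X) :
    potential A (l ∘ k.succAbove) (p ∘ k.succAbove) x = potential A l p x := by
  simp [potential, Fin.sum_univ_succAbove _ k, hk]

lemma energy_succAbove {l : Fin (m + 1) → ℝ} {k : Fin (m + 1)} (hk : l k = 0)
    (p : Fin (m + 1) → X) :
    energy A (l ∘ k.succAbove) (p ∘ k.succAbove) = energy A l p := by
  simp only [energy, potential_succAbove hk]
  simp [Fin.sum_univ_succAbove _ k, hk]

/-- A slot of weight zero may hold any point, which is how optimality is later tested against an
arbitrary point of the set. -/
lemma potential_update {l : Fin m → ℝ} {k : Fin m} (hk : l k = 0) (p : Fin m → X) (x y : X) :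
    potential A l (Function.update p k y) x = potential A l p x := by
  refine Finset.sum_congr rfl fun i _ => ?_
  rcases eq_or_ne i k with rfl | h
  · simp [hk]
  · simp [h]

lemma energy_update {l : Fin m → ℝ} {k : Fin m} (hk : l k = 0) (p : Fin m → X) (y : X) :
    energy A l (Function.update p k y) = energy A l p := by
  simp only [energy, potential_update hk]
  refine Finset.sum_congr rfl fun i _ => ?_
  rcases eq_or_ne i k with rfl | h
  · simp [hk]
  · simp [h]

/-- First order optimality of weights which maximize the energy. -/
lemma potential_le_of_isMax (hA : ∀ x y, A x y = A y x) (hself : ∀ x, A x x = 0)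
    (hnn : ∀ x y, 0 ≤ A x y) {l : Fin m → ℝ} (hl : l ∈ stdSimplex ℝ (Fin m)) {p : Fin m → X}
    (hmax : ∀ l' ∈ stdSimplex ℝ (Fin m), energy A l' p ≤ energy A l p) (j : Fin m) :
    potential A l p (p j) ≤ energy A l p := by
  set e := energy A l p with he
  set g := potential A l p (p j) with hg
  have he0 : 0 ≤ e := energy_nonneg hnn hl.1 p
  -- Move the weights a fraction `t` of the way towards the unit mass at `j`. The energy becomes `e
  -- + 2t(g - e) + t²(e - 2g)`, and maximality allows division by `t`.
  have key : ∀ t : ℝ, 0 < t → t < 1 → 2 * (1 - t) * (g - e) ≤ t * e := by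
    intro t ht ht1
    set a : Fin m → ℝ := Pi.single j 1 - l with ha
    have hmem : l + t • a ∈ stdSimplex ℝ (Fin m) := by
      have := (convex_stdSimplex ℝ (Fin m)) hl (single_mem_stdSimplex ℝ j)
        (sub_nonneg.2 ht1.le) ht.le (sub_add_cancel 1 t)
      convert this using 1
      ext i; simp [ha]; ring
    have h1 := hmax _ hmem
    rw [energy_add_smul hA] at h1
    have h2 : ∑ i, a i * potential A l p (p i) = g - e := by
      simp only [ha, Pi.sub_apply, sub_mul, Finset.sum_sub_distrib]
      simp [Pi.single_apply, he, hg, energy]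
    have h3 : energy A a p = e - 2 * g := by
      have h4 : a = Pi.single j 1 + (-1 : ℝ) • l := by ext i; simp [ha]; ring
      rw [h4, energy_add_smul hA]
      have h5 : energy A (Pi.single j 1) p = 0 := by
        simp [energy, potential, Pi.single_apply, hself]
      rw [h5, sum_mul_potential_comm hA]
      simp [Pi.single_apply, ← hg, ← he]; ring
    rw [h2, h3] at h1
    have h6 : t * (2 * (g - e) + t * (e - 2 * g)) ≤ 0 := by linarith
    have h7 := nonpos_of_mul_nonpos_right h6 ht
    linarith
  by_contra! hlt
  have hd : 0 < g - e := sub_pos.2 hlt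
  have hs : 0 < g - e + e + 1 := by linarith
  -- This `t` is small enough for a contradiction: with `d = g - e > 0` the inequality becomes `2(e
  -- + 1)d ≤ de`.
  have h := key ((g - e) / (g - e + e + 1)) (by positivity)
    (by rw [div_lt_one hs]; linarith)
  have h1 : 1 - (g - e) / (g - e + e + 1) = (e + 1) / (g - e + e + 1) := by
    field_simp; ring
  rw [h1] at h
  have h2 : 2 * (e + 1) * (g - e) ≤ (g - e) * e := by
    have h3 := mul_le_mul_of_nonneg_right h hs.le
    have h4 : 2 * ((e + 1) / (g - e + e + 1)) * (g - e) * (g - e + e + 1)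
        = 2 * (e + 1) * (g - e) := by field_simp
    have h5 : (g - e) / (g - e + e + 1) * e * (g - e + e + 1) = (g - e) * e := by field_simp
    linarith
  nlinarith

/-- Complementary slackness: the energy is the weighted mean of the potentials, none of which
exceeds it. -/
lemma potential_eq_of_isMax (hA : ∀ x y, A x y = A y x) (hself : ∀ x, A x x = 0)
    (hnn : ∀ x y, 0 ≤ A x y) {l : Fin m → ℝ} (hl : l ∈ stdSimplex ℝ (Fin m)) {p : Fin m → X}
    (hmax : ∀ l' ∈ stdSimplex ℝ (Fin m), energy A l' p ≤ energy A l p) (j : Fin m)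
    (hj : l j ≠ 0) : potential A l p (p j) = energy A l p := by
  have hle := potential_le_of_isMax hA hself hnn hl hmax
  have h0 : ∑ i, l i * (energy A l p - potential A l p (p i)) = 0 := by
    simp only [mul_sub, Finset.sum_sub_distrib, ← Finset.sum_mul, hl.2]
    simp [energy]
  have h1 := (Finset.sum_eq_zero_iff_of_nonneg
    (fun i _ => mul_nonneg (hl.1 i) (sub_nonneg.2 (hle i)))).1 h0 j (Finset.mem_univ j)
  have h2 := (mul_eq_zero.1 h1).resolve_left hj
  linarith

/-- Moving positive weights along a direction of total weight zero until one of them vanishes. -/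
lemma exists_add_smul_eq_zero {l a : Fin m → ℝ} (hl : l ∈ stdSimplex ℝ (Fin m)) (ha : a ≠ 0)
    (hs : ∑ i, a i = 0) : ∃ t : ℝ, ∃ k, l + t • a ∈ stdSimplex ℝ (Fin m) ∧ (l + t • a) k = 0 := by
  have hneg : ∃ i, a i < 0 := by
    by_contra! h
    exact ha (funext fun i => (Finset.sum_eq_zero_iff_of_nonneg (fun i _ => h i)).1 hs i
      (Finset.mem_univ i))
  obtain ⟨i₀, hi₀⟩ := hneg
  -- The smallest ratio `l i / -a i` is the step length at which the first weight reaches zero.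
  obtain ⟨k, hk, hmin⟩ := Finset.exists_min_image (Finset.univ.filter fun i => a i < 0)
    (fun i => l i / -a i) ⟨i₀, by simpa using hi₀⟩
  have hk' : a k < 0 := by simpa using hk
  refine ⟨l k / -a k, k, ⟨fun i => ?_, ?_⟩, ?_⟩
  · have ht : 0 ≤ l k / -a k := div_nonneg (hl.1 k) (by linarith)
    simp only [Pi.add_apply, Pi.smul_apply, smul_eq_mul]
    rcases lt_or_ge (a i) 0 with hi | hi
    · have h1 := hmin i (by simpa using hi)
      rw [le_div_iff₀ (by linarith)] at h1
      linarith
    · exact add_nonneg (hl.1 i) (mul_nonneg ht hi)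
  · simp [Finset.sum_add_distrib, ← Finset.mul_sum, hs, hl.2]
  · have h := neg_ne_zero.2 hk'.ne
    have h1 : l k / -a k * -a k = l k := div_mul_cancel₀ _ h
    simp only [Pi.add_apply, Pi.smul_apply, smul_eq_mul]
    linarith

/-- The gap in the upper bound of the energy is a sum of nonnegative terms. -/
lemma energy_gap {H : ℝ} (hself : ∀ x, A x x = 0) {l : Fin (m + 1) → ℝ} (hs : ∑ i, l i = 1)
    (p : Fin (m + 1) → X) :
    H * (m / (m + 1)) - energy A l p = H * ∑ i, (l i - 1 / (m + 1)) ^ 2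
      + ∑ j, ∑ i, if i = j then 0 else l j * l i * (H - A (p i) (p j)) := by
  have h1 : ∑ i, (l i - 1 / ((m : ℝ) + 1)) ^ 2 = ∑ i, l i ^ 2 - 1 / (m + 1) := by
    have : ∀ i, (l i - 1 / ((m : ℝ) + 1)) ^ 2
        = l i ^ 2 - 2 / (m + 1) * l i + (1 / (m + 1)) ^ 2 := fun i => by ring
    simp only [this, Finset.sum_add_distrib, Finset.sum_sub_distrib, ← Finset.mul_sum, hs]
    simp
    field_simp
    ring
  -- Since `A` vanishes on the diagonal, including the diagonal terms adds exactly `H * ∑ j, l j ^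
  -- 2`.
  have h2 : ∑ j, ∑ i, (if i = j then 0 else l j * l i * (H - A (p i) (p j)))
      = ∑ j, ∑ i, l j * l i * (H - A (p i) (p j)) - H * ∑ j, l j ^ 2 := by
    rw [Finset.mul_sum, ← Finset.sum_sub_distrib]
    refine Finset.sum_congr rfl fun j _ => ?_
    rw [eq_sub_iff_add_eq, ← Finset.add_sum_erase _ _ (Finset.mem_univ j),
      ← Finset.add_sum_erase Finset.univ (fun i => l j * l i * (H - A (p i) (p j)))
        (Finset.mem_univ j)]
    have : ∑ i ∈ Finset.univ.erase j, (if i = j then 0 else l j * l i * (H - A (p i) (p j)))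
        = ∑ i ∈ Finset.univ.erase j, l j * l i * (H - A (p i) (p j)) :=
      Finset.sum_congr rfl fun i hi => if_neg (Finset.ne_of_mem_erase hi)
    rw [this]
    simp [hself]
    ring
  have h3 : ∑ j, ∑ i, l j * l i * (H - A (p i) (p j)) = H - energy A l p := by
    rw [energy_eq_sum]
    simp only [mul_sub, Finset.sum_sub_distrib, ← Finset.mul_sum, ← Finset.sum_mul, hs]
    simp
  rw [h1, h2, h3]
  field_simp
  ring

lemma energy_le {H : ℝ} (hH : 0 ≤ H) (hself : ∀ x, A x x = 0) {l : Fin (m + 1) → ℝ}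
    (hl : l ∈ stdSimplex ℝ (Fin (m + 1))) {p : Fin (m + 1) → X} (hp : ∀ i j, A (p i) (p j) ≤ H) :
    energy A l p ≤ H * (m / (m + 1)) := by
  rw [← sub_nonneg, energy_gap hself hl.2]
  refine add_nonneg (mul_nonneg hH (Finset.sum_nonneg fun i _ => sq_nonneg _)) <|
    Finset.sum_nonneg fun j _ => Finset.sum_nonneg fun i _ => ?_
  split_ifs
  · exact le_rfl
  · exact mul_nonneg (mul_nonneg (hl.1 _) (hl.1 _)) (sub_nonneg.2 (hp _ _))

/-- When the gap is zero, its first sum makes every weight `1 / (m + 1)`. The weights being nonzero,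
the second sum then forces each `H - A (p i) (p j)` to vanish. -/
lemma chord_eq_of_energy_eq {H : ℝ} (hH : 0 < H) (hself : ∀ x, A x x = 0) {l : Fin (m + 1) → ℝ}
    (hl : l ∈ stdSimplex ℝ (Fin (m + 1))) {p : Fin (m + 1) → X} (hp : ∀ i j, A (p i) (p j) ≤ H)
    (he : energy A l p = H * (m / (m + 1))) (i j : Fin (m + 1)) (hij : i ≠ j) :
    A (p i) (p j) = H := by
  have h := energy_gap (H := H) hself hl.2 p
  rw [he, sub_self] at h
  have hnn : ∀ i j, 0 ≤ if i = j then 0 else l j * l i * (H - A (p i) (p j)) := by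
    intro i j
    split_ifs
    · exact le_rfl
    · exact mul_nonneg (mul_nonneg (hl.1 _) (hl.1 _)) (sub_nonneg.2 (hp _ _))
  have h1 : 0 ≤ H * ∑ i, (l i - 1 / ((m : ℝ) + 1)) ^ 2 :=
    mul_nonneg hH.le (Finset.sum_nonneg fun i _ => sq_nonneg _)
  have h2 : 0 ≤ ∑ j, ∑ i, if i = j then 0 else l j * l i * (H - A (p i) (p j)) :=
    Finset.sum_nonneg fun j _ => Finset.sum_nonneg fun i _ => hnn i j
  have h3 : ∑ i, (l i - 1 / ((m : ℝ) + 1)) ^ 2 = 0 := by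
    have : H * ∑ i, (l i - 1 / ((m : ℝ) + 1)) ^ 2 = 0 := by linarith
    exact (mul_eq_zero.1 this).resolve_left hH.ne'
  have h4 : ∑ j, ∑ i, (if i = j then 0 else l j * l i * (H - A (p i) (p j))) = 0 := by linarith
  have hw : ∀ i, l i ≠ 0 := fun i => by
    have := (Finset.sum_eq_zero_iff_of_nonneg (fun i _ => sq_nonneg _)).1 h3 i (Finset.mem_univ i)
    have h5 : l i = 1 / ((m : ℝ) + 1) := sub_eq_zero.1 (pow_eq_zero_iff (two_ne_zero) |>.1 this)
    rw [h5]
    positivity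
  have h5 := (Finset.sum_eq_zero_iff_of_nonneg
    (fun j _ => Finset.sum_nonneg fun i _ => hnn i j)).1 h4 j (Finset.mem_univ j)
  have h6 := (Finset.sum_eq_zero_iff_of_nonneg (fun i _ => hnn i j)).1 h5 i (Finset.mem_univ i)
  rw [if_neg hij] at h6
  have h7 := (mul_eq_zero.1 h6).resolve_left (mul_ne_zero (hw j) (hw i))
  linarith

lemma energy_const_eq {H : ℝ} (hself : ∀ x, A x x = 0) {p : Fin (m + 1) → X}
    (hp : ∀ i j, i ≠ j → A (p i) (p j) = H) :
    energy A (fun _ => 1 / ((m : ℝ) + 1)) p = H * (m / (m + 1)) := by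
  have h := energy_gap (H := H) hself (l := fun _ : Fin (m + 1) => 1 / ((m : ℝ) + 1))
    (by simp; field_simp) p
  have h2 : ∑ j, ∑ i, (if i = j then 0 else
      (1 / ((m : ℝ) + 1)) * (1 / ((m : ℝ) + 1)) * (H - A (p i) (p j))) = 0 :=
    Finset.sum_eq_zero fun j _ => Finset.sum_eq_zero fun i _ => by
      split_ifs with hij
      · rfl
      · rw [hp i j hij]; ring
  rw [h2] at h
  simp at h
  simp
  linarith

lemma const_mem_stdSimplex (m : ℕ) :
    (fun _ => 1 / ((m : ℝ) + 1)) ∈ stdSimplex ℝ (Fin (m + 1)) :=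
  ⟨fun _ => by positivity, by simp; field_simp⟩

end Energy

variable {k : Kind} {n : ℕ}

lemma gdist_le_diam {K : Set (Space k n)} (hK : BddAbove (distances K)) {x y : Space k n}
    (hx : x ∈ K) (hy : y ∈ K) : gdist x y ≤ diam K :=
  le_csSup hK ⟨x, hx, y, hy, rfl⟩

lemma nonempty_of_diam_pos {K : Set (Space k n)} (h : 0 < diam K) : K.Nonempty := by
  by_contra hne
  rw [Set.not_nonempty_iff_eq_empty] at hne
  have : distances (∅ : Set (Space k n)) = ∅ := by ext; simp [distances]
  rw [hne, diam, this, Real.sSup_empty] at h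
  exact h.false

/-! ### The theorem derived from the `JungSpace` axioms -/

namespace JungSpace

variable [TopologicalSpace (Space k n)] {D H : ℝ} {A : Space k n → Space k n → ℝ} {rad : ℝ → ℝ}

/-- The circumradius of a regular simplex, expressed by the energy of its vertices. -/
noncomputable def simplexRadius (n : ℕ) (H : ℝ) (rad : ℝ → ℝ) : ℝ := rad (H * (n / (n + 1)))

section

variable (J : JungSpace k n D H A rad)
include J

/-- Adding such a `y` would leave the diameter at most `D`. Compactness, convexity and the inradius
formula for complete sets all rest on this. -/
lemma mem_of_complete {K : Set (Space k n)} (hK : DiamComplete K) (hKD : diam K = D)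
    {y : Space k n} (hy : ∀ x ∈ K, gdist x y ≤ D) : y ∈ K := by
  by_contra hyK
  refine (hK.2 y hyK).not_ge (csSup_le ⟨_, y, Set.mem_insert y K, y, Set.mem_insert y K, rfl⟩ ?_)
  rw [hKD]
  rintro _ ⟨a, ha, b, hb, rfl⟩
  rcases ha with rfl | ha <;> rcases hb with rfl | hb
  · rw [J.dist_self]; exact J.D_pos.le
  · rw [J.dist_comm]; exact hy b hb
  · exact hy a ha
  · exact hKD ▸ gdist_le_diam hK.1 ha hb

lemma eq_iInter_ball {K : Set (Space k n)} (hK : DiamComplete K) (hKD : diam K = D) :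
    K = ⋂ x ∈ K, ball x D := by
  ext y
  simp only [Set.mem_iInter]
  exact ⟨fun hy x hx => hKD ▸ gdist_le_diam hK.1 hy hx,
    fun h => J.mem_of_complete hK hKD fun x hx => J.dist_comm x y ▸ h x hx⟩

lemma isClosed_ball (z : Space k n) : IsClosed (ball z D) := by
  have : ball z D = {x | A x z ≤ H} := Set.ext fun x => (J.chord_le_iff x z).symm
  rw [this]
  exact isClosed_le (J.continuous_chord.comp (by fun_prop : Continuous fun x => (x, z)))
    continuous_const

lemma isCompact_of_complete {K : Set (Space k n)} (hK : DiamComplete K) (hKD : diam K = D) :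
    IsCompact K := by
  obtain ⟨x, hx⟩ := nonempty_of_diam_pos (hKD.symm ▸ J.D_pos)
  have hc : IsClosed K := by
    rw [J.eq_iInter_ball hK hKD]
    exact isClosed_biInter fun x _ => J.isClosed_ball x
  exact (J.isCompact_ball x).of_isClosed_subset hc fun y hy => hKD ▸ gdist_le_diam hK.1 hy hx

lemma isConvex_ball (z : Space k n) {R : ℝ} (hR : R ≤ D) : IsConvex (ball z R) :=
  ⟨J.hemisphereCondition z _ fun _ hx => le_trans hx hR, J.geodSegment_subset z R hR⟩

/-- Weights and points of a compact set of diameter at most `D` for which every point of the set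
has potential at most the energy. -/
lemma exists_optimal {K : Set (Space k n)} (hc : IsCompact K) (hne : K.Nonempty)
    (hKD : ∀ x ∈ K, ∀ y ∈ K, gdist x y ≤ D) :
    ∃ (l : Fin (n + 1) → ℝ) (p : Fin (n + 1) → Space k n), l ∈ stdSimplex ℝ (Fin (n + 1)) ∧
      (∀ i, p i ∈ K) ∧ ∀ x ∈ K, potential A l p x ≤ energy A l p := by
  -- One point more than the `n + 1` finally kept: once a weight vanishes, its slot is free to test
  -- an arbitrary point of `K`.
  have hcomp : IsCompact ((stdSimplex ℝ (Fin (n + 2))) ×ˢ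
      (Set.univ.pi fun _ : Fin (n + 2) => K)) :=
    (isCompact_stdSimplex ℝ _).prod (isCompact_univ_pi fun _ => hc)
  have hcont : Continuous fun q : (Fin (n + 2) → ℝ) × (Fin (n + 2) → Space k n) =>
      energy A q.1 q.2 := by
    unfold energy potential
    refine continuous_finsetSum _ fun j _ => Continuous.mul (by fun_prop) <|
      continuous_finsetSum _ fun i _ => Continuous.mul (by fun_prop) ?_
    exact J.continuous_chord.comp
      (by fun_prop : Continuous fun q : (Fin (n + 2) → ℝ) × (Fin (n + 2) → Space k n) =>
        (q.2 i, q.2 j))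
  obtain ⟨x₀, hx₀⟩ := hne
  obtain ⟨⟨l, p⟩, ⟨hl, hp⟩, hmax⟩ := hcomp.exists_isMaxOn
    ⟨(Pi.single 0 1, fun _ => x₀), single_mem_stdSimplex ℝ 0, fun _ _ => hx₀⟩ hcont.continuousOn
  replace hp : ∀ i, p i ∈ K := fun i => hp i trivial
  replace hmax : ∀ l' ∈ stdSimplex ℝ (Fin (n + 2)), ∀ p' : Fin (n + 2) → Space k n,
      (∀ i, p' i ∈ K) → energy A l' p' ≤ energy A l p :=
    fun l' hl' p' hp' => hmax (a := (l', p')) ⟨hl', fun i _ => hp' i⟩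
  have hle : ∀ i j, A (p i) (p j) ≤ H := fun i j =>
    (J.chord_le_iff _ _).2 (hKD _ (hp i) _ (hp j))
  obtain ⟨l', c, hl', hc', he⟩ : ∃ l' : Fin (n + 2) → ℝ, ∃ c, l' ∈ stdSimplex ℝ (Fin (n + 2)) ∧
      l' c = 0 ∧ energy A l' p = energy A l p := by
    by_cases hz : ∃ c, l c = 0
    · exact ⟨l, hz.choose, hl, hz.choose_spec, rfl⟩
    push Not at hz
    -- With no zero weight, all potentials equal the energy, so `exists_dependence` gives a
    -- direction `a` along which the energy is constant.
    have hpot := fun j => potential_eq_of_isMax J.chord_comm J.chord_self J.chord_nonneg hl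
      (fun l' hl' => hmax l' hl' p hp) j (hz j)
    obtain ⟨a, ha, hs, ha'⟩ := J.exists_dependence l p hl hle hpot
    obtain ⟨t, c, hm, h0⟩ := exists_add_smul_eq_zero hl ha hs
    refine ⟨l + t • a, c, hm, h0, ?_⟩
    rw [energy_add_smul J.chord_comm, sum_mul_potential_comm J.chord_comm]
    simp [energy, ha']
  refine ⟨l' ∘ c.succAbove, p ∘ c.succAbove, ⟨fun i => hl'.1 _, ?_⟩, fun i => hp _, ?_⟩
  · have := hl'.2
    rw [Fin.sum_univ_succAbove _ c, hc', zero_add] at this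
    exact this
  · intro x hx
    rw [potential_succAbove hc', energy_succAbove hc']
    -- Put `x` into the free slot `c`: the family stays in `K` with the same energy, so it is still
    -- maximal, and optimality at `c` is the claim for `x`.
    have h := potential_le_of_isMax J.chord_comm J.chord_self J.chord_nonneg hl'
      (p := Function.update p c x) (fun l'' hl'' => by
        rw [energy_update hc', he]
        refine hmax l'' hl'' _ fun i => ?_
        rcases eq_or_ne i c with rfl | h
        · simpa using hx
        · simpa [h] using hp i) c
    rwa [Function.update_self, potential_update hc', energy_update hc'] at h

lemma fraction_mem : H * ((n : ℝ) / (n + 1)) ∈ Set.Icc 0 H :=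
  ⟨mul_nonneg J.H_pos.le (by positivity),
    mul_le_of_le_one_right J.H_pos.le ((div_le_one (by positivity)).2 (by linarith))⟩

/-- Jung's theorem with its equality case. -/
theorem jung {K : Set (Space k n)} (hc : IsCompact K) (hne : K.Nonempty)
    (hKD : ∀ x ∈ K, ∀ y ∈ K, gdist x y ≤ D) :
    IsLeast (outerRadii K) (circumradius K) ∧ circumradius K ≤ simplexRadius n H rad ∧
      (circumradius K = simplexRadius n H rad →
        ∃ v : Fin (n + 1) → Space k n, (∀ i, v i ∈ K) ∧ ∀ i j, i ≠ j → gdist (v i) (v j) = D) := by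
  obtain ⟨l, p, hl, hp, hopt⟩ := J.exists_optimal hc hne hKD
  have hle : ∀ i j, A (p i) (p j) ≤ H := fun i j =>
    (J.chord_le_iff _ _).2 (hKD _ (hp i) _ (hp j))
  have he0 := energy_nonneg J.chord_nonneg hl.1 p
  have he1 := energy_le J.H_pos.le J.chord_self hl hle
  have heH : energy A l p ∈ Set.Icc 0 H := ⟨he0, he1.trans J.fraction_mem.2⟩
  obtain ⟨z, hz⟩ := J.exists_center _ l p hl hle
  have hleast : IsLeast (outerRadii K) (rad (energy A l p)) :=
    ⟨⟨J.rad_nonneg _ he0, z, fun x hx => hz x (hopt x hx)⟩, fun R hR => by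
      obtain ⟨-, z', hz'⟩ := hR
      exact J.rad_le _ l p hl hle z' R fun i => hz' (hp i)⟩
  have hR : circumradius K = rad (energy A l p) := hleast.csInf_eq
  rw [hR]
  refine ⟨hleast, J.rad_strictMono.monotoneOn heH J.fraction_mem he1, fun heq => ?_⟩
  -- Equal radii mean equal energies, which puts the family in the equality case of the energy
  -- bound.
  have he := J.rad_strictMono.injOn heH J.fraction_mem heq
  exact ⟨p, hp, fun i j hij => J.dist_eq_of_chord_eq _ _ <|
    chord_eq_of_energy_eq J.H_pos J.chord_self hl hle he i j hij⟩

/-- Uniform weights on the vertices attain the maximal energy, so `rad_le` applies with that value.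
-/
lemma simplexRadius_le {v : Fin (n + 1) → Space k n} (hv : ∀ i j, i ≠ j → gdist (v i) (v j) = D)
    {z : Space k n} {R : ℝ} (hz : ∀ i, gdist (v i) z ≤ R) : simplexRadius n H rad ≤ R := by
  have hA := fun i j hij => J.chord_eq_of_dist_eq _ _ (hv i j hij)
  have hle : ∀ i j, A (v i) (v j) ≤ H := fun i j => by
    rcases eq_or_ne i j with rfl | h
    · rw [J.chord_self]; exact J.H_pos.le
    · exact (hA i j h).le
  have := J.rad_le _ _ v (const_mem_stdSimplex n) hle z R hz
  rwa [energy_const_eq J.chord_self hA] at this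

lemma gdist_vertex_le {v : Fin (n + 1) → Space k n}
    (hv : ∀ i j, i ≠ j → gdist (v i) (v j) = D) (i j : Fin (n + 1)) : gdist (v i) (v j) ≤ D := by
  rcases eq_or_ne i j with rfl | h
  · rw [J.dist_self]; exact J.D_pos.le
  · exact (hv i j h).le

/-- The circumradius of a regular simplex. -/
lemma isLeast_simplexRadius {v : Fin (n + 1) → Space k n}
    (hv : ∀ i j, i ≠ j → gdist (v i) (v j) = D) :
    IsLeast (outerRadii (hull (Set.range v))) (simplexRadius n H rad) := by
  have hsub : Set.range v ⊆ hull (Set.range v) := Set.subset_sInter fun C hC => hC.2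
  obtain ⟨⟨⟨h0, z, hz⟩, -⟩, hle, -⟩ := J.jung (K := Set.range v) (Set.finite_range v).isCompact
    (Set.range_nonempty v) (by
      rintro _ ⟨i, rfl⟩ _ ⟨j, rfl⟩
      exact J.gdist_vertex_le hv i j)
  refine ⟨⟨h0.trans hle, z, ?_⟩, ?_⟩
  -- The hull stays in a ball around the vertices once that ball is convex, for which its radius
  -- must be at most `D`; the ball of radius `D` about a vertex shows this.
  · refine Set.sInter_subset_of_mem ⟨J.isConvex_ball z ?_, fun x hx => (hz hx).trans hle⟩
    exact J.simplexRadius_le hv fun i => J.gdist_vertex_le hv i 0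
  · rintro R ⟨-, z', hz'⟩
    exact J.simplexRadius_le hv fun i => hz' (hsub ⟨i, rfl⟩)

/-- Any two regular simplices of the same edge length are congruent. -/
lemma exists_isometry {v w : Fin (n + 1) → Space k n}
    (hv : ∀ i j, i ≠ j → gdist (v i) (v j) = D) (hw : ∀ i j, i ≠ j → gdist (w i) (w j) = D) :
    ∃ φ : Space k n ≃ Space k n, (∀ x y, gdist (φ x) (φ y) = gdist x y) ∧ ∀ i, φ (v i) = w i := by
  have key : ∀ m : ℕ, ∃ φ : Space k n ≃ Space k n, (∀ x y, gdist (φ x) (φ y) = gdist x y) ∧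
      ∀ i : Fin (n + 1), (i : ℕ) < m → φ (v i) = w i := by
    intro m
    induction m with
    | zero => exact ⟨Equiv.refl _, fun _ _ => rfl, fun i hi => absurd hi (Nat.not_lt_zero _)⟩
    | succ m ih =>
      obtain ⟨φ, hφ, hφv⟩ := ih
      by_cases hm : m < n + 1
      · by_cases hfix : φ (v ⟨m, hm⟩) = w ⟨m, hm⟩
        · refine ⟨φ, hφ, fun i hi => ?_⟩
          rcases Nat.lt_succ_iff_lt_or_eq.1 hi with h | h
          · exact hφv i h
          · have : i = ⟨m, hm⟩ := Fin.ext h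
            rw [this, hfix]
        · obtain ⟨σ, hσ, hσx, hσf⟩ := J.exists_reflection _ _ hfix
          refine ⟨φ.trans σ, fun x y => by simp [hσ, hφ], fun i hi => ?_⟩
          rcases Nat.lt_succ_iff_lt_or_eq.1 hi with h | h
          · have hne : i ≠ ⟨m, hm⟩ := fun e => by simp [e] at h
            rw [Equiv.trans_apply, hφv i h]
            -- Vertices already matched are at distance `D` from both the old and the new position
            -- of vertex `m`, so the reflection fixes them.
            refine hσf _ ?_
            rw [hw _ _ hne, ← hφv i h, hφ, hv _ _ hne]
          · have : i = ⟨m, hm⟩ := Fin.ext h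
            rw [this, Equiv.trans_apply, hσx]
      · exact ⟨φ, hφ, fun i _ => hφv i (by omega)⟩
  obtain ⟨φ, hφ, h⟩ := key (n + 1)
  exact ⟨φ, hφ, fun i => h i i.2⟩

/-- The preimage of `K` under the isometry is convex and contains the vertices, hence the hull. -/
lemma containsCongruentCopy {K : Set (Space k n)} (hK : DiamComplete K) (hKD : diam K = D)
    {v w : Fin (n + 1) → Space k n} (hv : ∀ i j, i ≠ j → gdist (v i) (v j) = D)
    (hw : ∀ i j, i ≠ j → gdist (w i) (w j) = D) (hwK : ∀ i, w i ∈ K) :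
    ContainsCongruentCopy K (hull (Set.range v)) := by
  obtain ⟨φ, hφ, hφv⟩ := J.exists_isometry hv hw
  refine ⟨φ, hφ, ?_⟩
  rw [Set.image_subset_iff]
  have hpre : ∀ x, gdist (φ x) = fun y => gdist x (φ.symm y) := fun x => funext fun y => by
    rw [← hφ x, φ.apply_symm_apply]
  refine Set.sInter_subset_of_mem ⟨⟨?_, ?_⟩, ?_⟩
  · refine J.hemisphereCondition (v 0) _ fun x hx => ?_
    change gdist x (v 0) ≤ D
    rw [← hφ, hφv]
    exact hKD ▸ gdist_le_diam hK.1 hx (hwK 0)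
  · intro a ha b hb c hc
    -- Pulling back the balls of radius `D` about points of `K` gives balls again, so nothing need
    -- be known about how the isometry acts on segments.
    refine J.mem_of_complete hK hKD fun x hx => ?_
    rw [J.dist_comm, hpre]
    refine J.geodSegment_subset (φ.symm x) D le_rfl a ?_ b ?_ hc
    · change gdist a (φ.symm x) ≤ D
      rw [← congrFun (hpre a) x]
      exact hKD ▸ gdist_le_diam hK.1 ha hx
    · change gdist b (φ.symm x) ≤ D
      rw [← congrFun (hpre b) x]
      exact hKD ▸ gdist_le_diam hK.1 hb hx
  · rintro _ ⟨i, rfl⟩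
    rw [Set.mem_preimage, hφv]
    exact hwK i

/-- A complete set of diameter `D` satisfies `r(K) + R(K) = D`. -/
lemma isGreatest_sub_circumradius {K : Set (Space k n)} (hK : DiamComplete K) (hKD : diam K = D)
    (hR : IsLeast (outerRadii K) (circumradius K)) :
    IsGreatest (innerRadii K) (D - circumradius K) := by
  have hKle : ∀ x ∈ K, ∀ y ∈ K, gdist x y ≤ D := fun x hx y hy => hKD ▸ gdist_le_diam hK.1 hx hy
  obtain ⟨a, ha⟩ := nonempty_of_diam_pos (hKD.symm ▸ J.D_pos)
  refine ⟨⟨?_, ?_⟩, ?_⟩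
  · exact sub_nonneg.2 (hR.2 ⟨J.D_pos.le, a, fun x hx => hKle x hx a ha⟩)
  · obtain ⟨-, z, hz⟩ := hR.1
    -- By the triangle inequality through the circumcentre, points this close to it are within `D`
    -- of all of `K`.
    refine ⟨z, fun y hy => J.mem_of_complete hK hKD fun x hx => ?_⟩
    have h1 : gdist x z ≤ circumradius K := hz hx
    have h2 : gdist y z ≤ D - circumradius K := hy
    have h3 := J.dist_triangle x z y
    rw [J.dist_comm z y] at h3
    linarith
  · rintro r ⟨hr, z, hz⟩
    have hzK : z ∈ K := hz (by change gdist z z ≤ r; rwa [J.dist_self])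
    -- Prolong the geodesic from `x` beyond `z` to a point of the inner ball, hence of `K`. The
    -- truncation at `D` meets the length bound in `exists_extension`.
    have key : ∀ x ∈ K, gdist x z + min r D ≤ D := by
      intro x hx
      rcases eq_or_ne x z with rfl | hxz
      · rw [J.dist_self, zero_add]; exact min_le_right _ _
      · obtain ⟨y, hyz, hxy⟩ := J.exists_extension x z (min r D) (le_min hr J.D_pos.le)
          (min_le_right _ _) hxz (hKle x hx z hzK)
        exact hxy.trans (hKle x hx y (hz (hyz.trans (min_le_left _ _))))
    rcases lt_or_ge r D with h | h
    · rw [min_eq_left h.le] at key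
      have hmem : D - r ∈ outerRadii K :=
        ⟨by linarith, z, fun x hx => show gdist x z ≤ D - r by linarith [key x hx]⟩
      linarith [hR.2 hmem]
    -- If `r ≥ D`, every point of `K` is at distance at most 0 from `z`, contradicting the positive
    -- diameter.
    · rw [min_eq_right h] at key
      have hd : diam K ≤ 0 := csSup_le ⟨_, a, ha, a, ha, rfl⟩ <| by
        rintro _ ⟨x, hx, y, hy, rfl⟩
        have h3 := J.dist_triangle x z y
        rw [J.dist_comm z y] at h3
        linarith [key x hx, key y hy]
      linarith [J.D_pos]

theorem complete_radii {K : Set (Space k n)} (hK : DiamComplete K) (hKD : diam K = D) :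
    IsLeast (outerRadii K) (circumradius K) ∧
    IsGreatest (innerRadii K) (inradius K) ∧
    (∃ S : Set (Space k n), IsRegularSimplex D S) ∧
    ∀ S : Set (Space k n), IsRegularSimplex D S →
      IsLeast (outerRadii S) (circumradius S) ∧
      circumradius K ≤ circumradius S ∧
      D - circumradius S ≤ inradius K ∧
      (circumradius K = circumradius S ↔ ContainsCongruentCopy K S) ∧
      (inradius K = D - circumradius S ↔ ContainsCongruentCopy K S) := by
  obtain ⟨hR, hle, heq⟩ := J.jung (J.isCompact_of_complete hK hKD)
    (nonempty_of_diam_pos (hKD.symm ▸ J.D_pos))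
    fun x hx y hy => hKD ▸ gdist_le_diam hK.1 hx hy
  have hr := J.isGreatest_sub_circumradius hK hKD hR
  have hr' : inradius K = D - circumradius K := hr.csSup_eq
  obtain ⟨v₀, hv₀⟩ := J.exists_simplex
  refine ⟨hR, hr' ▸ hr, ⟨_, v₀, hv₀, rfl⟩, ?_⟩
  rintro S ⟨v, hv, rfl⟩
  have hS := J.isLeast_simplexRadius hv
  have hS' : circumradius (hull (Set.range v)) = simplexRadius n H rad := hS.csInf_eq
  have hiff : circumradius K = simplexRadius n H rad ↔
      ContainsCongruentCopy K (hull (Set.range v)) := by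
    constructor
    · intro h
      obtain ⟨w, hwK, hw⟩ := heq h
      exact J.containsCongruentCopy hK hKD hv hw hwK
    · rintro ⟨φ, hφ, hsub⟩
      refine le_antisymm hle ?_
      obtain ⟨-, z, hz⟩ := hR.1
      have hmem : ∀ i, v i ∈ hull (Set.range v) := fun i C hC => hC.2 ⟨i, rfl⟩
      exact J.simplexRadius_le (v := fun i => φ (v i))
        (fun i j hij => by rw [hφ, hv i j hij]) fun i => hz (hsub ⟨v i, hmem i, rfl⟩)
  rw [hS', hr']
  refine ⟨hS, hle, by linarith, hiff, ?_⟩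
  rw [← hiff]
  constructor <;> intro h <;> linarith

end

end JungSpace

/-! ### Euclidean space -/

section Euclidean

/-- The squared distance of `ℝⁿ`. -/
noncomputable def eucChord (x y : Euc n) : ℝ := ‖x - y‖ ^ 2

lemma sum_smul_sub_eq_zero {m : ℕ} {l : Fin m → ℝ} (hs : ∑ i, l i = 1) (p : Fin m → Euc n) :
    ∑ i, l i • (p i - ∑ j, l j • p j) = 0 := by
  simp only [smul_sub, Finset.sum_sub_distrib, ← Finset.sum_smul, hs, one_smul, sub_self]

lemma eucChord_expand (p w x : Euc n) :
    eucChord p x = eucChord p w + 2 * inner ℝ (p - w) (w - x) + eucChord w x := by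
  rw [eucChord, ← sub_add_sub_cancel p w x, norm_add_sq_real]
  rfl

/-- Steiner's parallel axis formula: the cross term vanishes at the barycentre. -/
lemma potential_eucChord {m : ℕ} {l : Fin m → ℝ} (hs : ∑ i, l i = 1) (p : Fin m → Euc n)
    (x : Euc n) : potential eucChord l p x
      = potential eucChord l p (∑ i, l i • p i) + eucChord (∑ i, l i • p i) x := by
  set w := ∑ i, l i • p i with hw
  have h : ∑ i, l i * inner ℝ (p i - w) (w - x) = 0 := by
    simp only [← real_inner_smul_left]
    rw [← sum_inner, sum_smul_sub_eq_zero hs, inner_zero_left]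
  have h1 : ∀ i, l i * eucChord (p i) x = l i * eucChord (p i) w
      + 2 * (l i * inner ℝ (p i - w) (w - x)) + l i * eucChord w x := fun i => by
    rw [eucChord_expand (p i) w x]; ring
  simp only [potential, h1, Finset.sum_add_distrib, ← Finset.mul_sum, ← Finset.sum_mul, hs, h]
  ring

lemma eucChord_comm (x y : Euc n) : eucChord x y = eucChord y x := by
  rw [eucChord, norm_sub_rev, eucChord]

/-- Average the parallel axis formula over the points. The factor 2 is why the radius is `√(e / 2)`.
-/
lemma energy_eucChord {m : ℕ} {l : Fin m → ℝ} (hs : ∑ i, l i = 1) (p : Fin m → Euc n) :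
    energy eucChord l p = 2 * potential eucChord l p (∑ i, l i • p i) := by
  simp only [energy]
  simp_rw [potential_eucChord hs p (p _), mul_add]
  rw [Finset.sum_add_distrib, ← Finset.sum_mul, hs, one_mul, two_mul]
  congr 1
  exact Finset.sum_congr rfl fun i _ => by rw [eucChord_comm]

lemma euc_exists_center {m : ℕ} {l : Fin m → ℝ} (hs : ∑ i, l i = 1) (p : Fin m → Euc n) :
    ∃ z : Euc n, ∀ x, potential eucChord l p x ≤ energy eucChord l p →
      dist x z ≤ √(energy eucChord l p / 2) := by
  refine ⟨∑ i, l i • p i, fun x hx => Real.le_sqrt_of_sq_le ?_⟩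
  rw [potential_eucChord hs, energy_eucChord hs] at hx
  rw [energy_eucChord hs, dist_eq_norm, norm_sub_rev]
  rw [eucChord] at hx
  linarith

lemma euc_rad_le {m : ℕ} {l : Fin m → ℝ} (hl : l ∈ stdSimplex ℝ (Fin m)) (p : Fin m → Euc n)
    (z : Euc n) (R : ℝ) (h : ∀ i, dist (p i) z ≤ R) : √(energy eucChord l p / 2) ≤ R := by
  have hR : 0 ≤ R := by
    rcases m with _ | m
    · simpa using hl.2
    · exact dist_nonneg.trans (h 0)
  rw [Real.sqrt_le_left hR, energy_eucChord hl.2, mul_div_cancel_left₀ _ two_ne_zero]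
  have h1 : potential eucChord l p z ≤ ∑ i, l i * R ^ 2 := by
    refine Finset.sum_le_sum fun i _ => mul_le_mul_of_nonneg_left ?_ (hl.1 i)
    rw [eucChord, ← dist_eq_norm]
    exact pow_le_pow_left₀ dist_nonneg (h i) 2
  rw [← Finset.sum_mul, hl.2, one_mul, potential_eucChord hl.2] at h1
  have : 0 ≤ eucChord (∑ i, l i • p i) z := sq_nonneg _
  linarith

/-- Equal potentials place all points on one sphere about the barycentre. There the squared distance
to `p j` is an affine function of `p i`, which an affine dependence annihilates. -/
lemma euc_exists_dependence {l : Fin (n + 2) → ℝ} (hs : ∑ i, l i = 1) (p : Fin (n + 2) → Euc n)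
    (h : ∀ j, potential eucChord l p (p j) = energy eucChord l p) :
    ∃ a : Fin (n + 2) → ℝ, a ≠ 0 ∧ ∑ i, a i = 0 ∧ ∀ j, potential eucChord a p (p j) = 0 := by
  have hdep : ¬ LinearIndependent ℝ fun i => ((1 : ℝ), p i) := fun hli => by
    have := hli.fintype_card_le_finrank
    simp at this
    omega
  obtain ⟨a, ha, i, hi⟩ := Fintype.not_linearIndependent_iff.1 hdep
  have ha1 : ∑ i, a i = 0 := by simpa [Prod.fst_sum] using congrArg Prod.fst ha
  have ha2 : ∑ i, a i • p i = 0 := by simpa [Prod.snd_sum] using congrArg Prod.snd ha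
  refine ⟨a, fun h0 => hi (by simp [h0]), ha1, fun j => ?_⟩
  set w := ∑ i, l i • p i with hw
  set V := potential eucChord l p w with hV
  have hpw : ∀ i, eucChord (p i) w = V := fun i => by
    have h1 := h i
    rw [potential_eucChord hs, energy_eucChord hs, ← hw] at h1
    rw [eucChord_comm]
    linarith
  have h2 : ∑ i, a i * inner ℝ (p i - w) (w - p j) = 0 := by
    simp only [← real_inner_smul_left]
    rw [← sum_inner]
    simp [smul_sub, Finset.sum_sub_distrib, ← Finset.sum_smul, ha1, ha2]
  have h3 : ∀ i, a i * eucChord (p i) (p j) = a i * V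
      + 2 * (a i * inner ℝ (p i - w) (w - p j)) + a i * eucChord w (p j) := fun i => by
    rw [eucChord_expand (p i) w (p j), hpw]; ring
  simp only [potential, h3, Finset.sum_add_distrib, ← Finset.mul_sum, ← Finset.sum_mul, ha1, h2]
  ring

lemma euc_exists_extension {x z : Euc n} {r : ℝ} (hr : 0 ≤ r) (hxz : x ≠ z) :
    ∃ y : Euc n, dist y z ≤ r ∧ dist x z + r ≤ dist x y := by
  have hd : 0 < ‖z - x‖ := norm_pos_iff.2 (sub_ne_zero.2 hxz.symm)
  refine ⟨z + (r / ‖z - x‖) • (z - x), ?_, ?_⟩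
  · rw [dist_eq_norm, add_sub_cancel_left, norm_smul, Real.norm_of_nonneg (by positivity)]
    exact (div_mul_cancel₀ _ hd.ne').le
  · have h : z + (r / ‖z - x‖) • (z - x) - x = (1 + r / ‖z - x‖) • (z - x) := by
      module
    rw [dist_comm x, dist_comm x, dist_eq_norm, dist_eq_norm, h, norm_smul,
      Real.norm_of_nonneg (by positivity), add_mul, one_mul, div_mul_cancel₀ _ hd.ne']

/-- Reflect in the perpendicular bisector: the linear reflection in the complement of `x - y`,
recentred at the midpoint. -/
lemma euc_exists_reflection (x y : Euc n) : ∃ σ : Euc n ≃ Euc n,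
    (∀ a b, dist (σ a) (σ b) = dist a b) ∧ σ x = y ∧ ∀ z, dist z x = dist z y → σ z = z := by
  set m : Euc n := (1 / 2 : ℝ) • (x + y) with hm
  set T := (Submodule.span ℝ {x - y})ᗮ.reflection with hT
  refine ⟨((Equiv.subRight m).trans T.toEquiv).trans (Equiv.addRight m), fun a b => ?_, ?_,
    fun z hz => ?_⟩
  · change dist (T (a - m) + m) (T (b - m) + m) = dist a b
    rw [dist_add_right, T.dist_map, dist_sub_right]
  · change T (x - m) + m = y
    have h : x - m = (1 / 2 : ℝ) • (x - y) := by rw [hm]; module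
    rw [h, map_smul, Submodule.reflection_orthogonalComplement_singleton_eq_neg, hm]
    module
  · change T (z - m) + m = z
    have h : z - m ∈ (Submodule.span ℝ {x - y})ᗮ := by
      rw [Submodule.mem_orthogonal_singleton_iff_inner_right]
      have h1 : ‖z - x‖ ^ 2 = ‖z - y‖ ^ 2 := by rw [← dist_eq_norm, ← dist_eq_norm, hz]
      rw [norm_sub_sq_real, norm_sub_sq_real] at h1
      have h2 : inner ℝ (x - y) (z - m)
          = inner ℝ z x - inner ℝ z y - (‖x‖ ^ 2 - ‖y‖ ^ 2) / 2 := by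
        rw [hm, inner_sub_right, inner_smul_right, inner_add_right, inner_sub_left, inner_sub_left,
          inner_sub_left, real_inner_self_eq_norm_sq, real_inner_self_eq_norm_sq,
          real_inner_comm x z, real_inner_comm y z, real_inner_comm x y]
        ring
      rw [h2]
      linarith
    rw [Submodule.reflection_mem_subspace_eq_self h, sub_add_cancel]

lemma eucSegment_subset {z x y : Euc n} {R : ℝ} (hx : dist x z ≤ R) (hy : dist y z ≤ R) :
    eucSegment x y ⊆ {q | dist q z ≤ R} := by
  rintro q ⟨u, t, s, -, hs, hst, rfl, rfl⟩
  rcases hs.eq_or_lt with rfl | hs'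
  · simpa using hx
  have ht : 0 < t := hs'.trans_le hst
  have := (convex_closedBall z R) (Metric.mem_closedBall.2 hx) (Metric.mem_closedBall.2 hy)
    (sub_nonneg.2 ((div_le_one ht).2 hst)) (div_nonneg hs ht.le) (sub_add_cancel 1 (s / t))
  have h : (1 - s / t) • x + (s / t) • (x + t • u) = x + s • u := by
    rw [smul_add, smul_smul, div_mul_cancel₀ _ ht.ne']
    module
  rw [h] at this
  exact Metric.mem_closedBall.1 this

lemma euc_exists_simplex (hn : n ≠ 0) {D : ℝ} (hD : 0 < D) :
    ∃ v : Fin (n + 1) → Euc n, ∀ i j, i ≠ j → dist (v i) (v j) = D := by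
  have hn' : (0 : ℝ) < n := by exact_mod_cast Nat.pos_of_ne_zero hn
  set a := D / √2 with ha
  have ha2 : 2 * a ^ 2 = D ^ 2 := by
    rw [ha, div_pow, Real.sq_sqrt zero_le_two]; field_simp
  -- The vertices are `a e_i` and `(b, …, b)`; `b` is a root of `n b² - 2ab + a² = 2a²`, which
  -- equates the remaining edges with `D`.
  set b := a * (1 + √(1 + n)) / n with hb
  have hb2 : n * b ^ 2 - 2 * a * b - a ^ 2 = 0 := by
    have h := Real.sq_sqrt (show (0 : ℝ) ≤ 1 + n by positivity)
    have h1 : n * b = a * (1 + √(1 + n)) := by rw [hb]; field_simp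
    have h2 : n * (n * b ^ 2 - 2 * a * b - a ^ 2) = 0 := by
      have : n * (n * b ^ 2 - 2 * a * b - a ^ 2) = (n * b) ^ 2 - 2 * a * (n * b) - n * a ^ 2 := by
        ring
      rw [this, h1]
      linear_combination a ^ 2 * h
    exact (mul_eq_zero.1 h2).resolve_left hn'.ne'
  set c : Euc n := WithLp.toLp 2 fun _ => b with hc
  have hce : ∀ i, dist c (EuclideanSpace.single i a) = D := fun i => by
    rw [dist_eq_norm, ← sq_eq_sq₀ (norm_nonneg _) hD.le, norm_sub_sq_real, real_inner_comm,
      EuclideanSpace.inner_single_left, PiLp.norm_single, EuclideanSpace.real_norm_sq_eq]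
    simp [hc]
    linarith
  have hee : ∀ i j : Fin n, i ≠ j →
      dist (EuclideanSpace.single i a) (EuclideanSpace.single j a) = D := fun i j hij => by
    rw [dist_eq_norm, ← sq_eq_sq₀ (norm_nonneg _) hD.le, norm_sub_sq_real,
      EuclideanSpace.inner_single_left, PiLp.norm_single, PiLp.norm_single]
    simp [hij]
    linarith
  refine ⟨Fin.cons c fun i => EuclideanSpace.single i a, fun i j hij => ?_⟩
  induction i using Fin.cases with
  | zero =>
    induction j using Fin.cases with
    | zero => exact absurd rfl hij
    | succ j => simpa using hce j
  | succ i =>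
    induction j using Fin.cases with
    | zero => rw [dist_comm]; simpa using hce i
    | succ j => simpa using hee i j fun h => hij (by rw [h])

instance : TopologicalSpace (Space .euclidean n) := inferInstanceAs (TopologicalSpace (Euc n))

lemma jungSpace_euclidean (hn : n ≠ 0) {D : ℝ} (hD : 0 < D) :
    JungSpace .euclidean n D (D ^ 2)
      (eucChord (n := n)) (fun e => √(e / 2)) := by
  have hsq : ∀ x y : Euc n, eucChord x y = dist x y ^ 2 := fun x y => by
    rw [eucChord, dist_eq_norm]
  have hself : ∀ x : Euc n, eucChord x x = 0 := fun x => by simp [eucChord]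
  have hle : ∀ x y : Euc n, eucChord x y ≤ D ^ 2 ↔ dist x y ≤ D := fun x y => by
    rw [hsq]
    exact sq_le_sq₀ dist_nonneg hD.le
  have heq : ∀ x y : Euc n, eucChord x y = D ^ 2 ↔ dist x y = D := fun x y => by
    rw [hsq]
    exact sq_eq_sq₀ dist_nonneg hD.le
  exact
  { D_pos := hD
    H_pos := by positivity
    dist_self := fun x => dist_self (α := Euc n) x
    dist_comm := fun x y => dist_comm (α := Euc n) x y
    dist_triangle := fun x y z => dist_triangle (α := Euc n) x y z
    continuous_chord := by
      change Continuous fun q : Euc n × Euc n => ‖q.1 - q.2‖ ^ 2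
      fun_prop
    chord_comm := eucChord_comm (n := n)
    chord_self := hself
    chord_nonneg := fun x y => sq_nonneg _
    chord_le_iff := hle
    dist_eq_of_chord_eq := fun x y => (heq x y).1
    chord_eq_of_dist_eq := fun x y => (heq x y).2
    isCompact_ball := fun z => isCompact_closedBall (α := Euc n) z D
    rad_nonneg := fun e _ => Real.sqrt_nonneg _
    rad_strictMono := fun a ha b _ hab =>
      Real.sqrt_lt_sqrt (div_nonneg ha.1 zero_le_two) (by linarith)
    exists_center := fun m l p hl _ => euc_exists_center hl.2 p
    rad_le := fun m l p hl _ z R h => euc_rad_le hl p z R h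
    exists_dependence := fun l p hl _ h => euc_exists_dependence hl.2 p h
    exists_extension := fun x z r hr _ hxz _ => euc_exists_extension hr hxz
    exists_reflection := fun x y _ => euc_exists_reflection x y
    hemisphereCondition := fun _ _ _ => trivial
    geodSegment_subset := fun z R _ x hx y hy => eucSegment_subset hx hy
    exists_simplex := euc_exists_simplex hn hD }

end Euclidean

/-! ### The sphere -/

section Spherical

/-- The chord function `1 - ⟨x, y⟩` of `Sⁿ`. -/
noncomputable def sphChord (x y : Sph n) : ℝ := 1 - inner ℝ (x : Euc (n + 1)) (y : Euc (n + 1))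

lemma norm_coe_sph (x : Sph n) : ‖(x : Euc (n + 1))‖ = 1 := mem_sphere_zero_iff_norm.1 x.2

lemma inner_coe_self_sph (x : Sph n) : inner ℝ (x : Euc (n + 1)) (x : Euc (n + 1)) = 1 := by
  rw [real_inner_self_eq_norm_sq, norm_coe_sph, one_pow]

lemma dist_coe_sph_le (x y : Sph n) : dist (x : Euc (n + 1)) (y : Euc (n + 1)) / 2 ≤ 1 := by
  have h := norm_sub_le (x : Euc (n + 1)) (y : Euc (n + 1))
  rw [norm_coe_sph, norm_coe_sph, ← dist_eq_norm] at h
  linarith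

lemma sphDist_nonneg (x y : Sph n) : 0 ≤ sphDist x y :=
  mul_nonneg zero_le_two (Real.arcsin_nonneg.2 (div_nonneg dist_nonneg zero_le_two))

lemma sphDist_le_pi (x y : Sph n) : sphDist x y ≤ Real.pi := by
  have := Real.arcsin_le_pi_div_two (dist (x : Euc (n + 1)) (y : Euc (n + 1)) / 2)
  rw [sphDist]
  linarith

lemma cos_sphDist (x y : Sph n) :
    Real.cos (sphDist x y) = inner ℝ (x : Euc (n + 1)) (y : Euc (n + 1)) := by
  have h0 : (-1 : ℝ) ≤ dist (x : Euc (n + 1)) (y : Euc (n + 1)) / 2 := by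
    have : 0 ≤ dist (x : Euc (n + 1)) (y : Euc (n + 1)) / 2 := by positivity
    linarith
  rw [sphDist, Real.cos_two_mul, Real.cos_sq', Real.sin_arcsin h0 (dist_coe_sph_le x y),
    dist_eq_norm, div_pow, norm_sub_sq_real, norm_coe_sph, norm_coe_sph]
  ring

lemma sphDist_eq_arccos (x y : Sph n) :
    sphDist x y = Real.arccos (inner ℝ (x : Euc (n + 1)) (y : Euc (n + 1))) := by
  rw [← cos_sphDist, Real.arccos_cos (sphDist_nonneg x y) (sphDist_le_pi x y)]

lemma sphDist_eq_angle (x y : Sph n) :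
    sphDist x y = InnerProductGeometry.angle (x : Euc (n + 1)) (y : Euc (n + 1)) := by
  rw [sphDist_eq_arccos, InnerProductGeometry.angle, norm_coe_sph, norm_coe_sph, mul_one, div_one]

lemma sphDist_le_iff {x y : Sph n} {R : ℝ} (h0 : 0 ≤ R) (h1 : R ≤ Real.pi) :
    sphDist x y ≤ R ↔ Real.cos R ≤ inner ℝ (x : Euc (n + 1)) (y : Euc (n + 1)) := by
  rw [← cos_sphDist]
  exact (Real.strictAntiOn_cos.le_iff_ge ⟨h0, h1⟩ ⟨sphDist_nonneg x y, sphDist_le_pi x y⟩).symm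

lemma potential_sphChord {m : ℕ} {l : Fin m → ℝ} (hs : ∑ i, l i = 1) (p : Fin m → Sph n)
    (x : Sph n) : potential sphChord l p x
      = 1 - inner ℝ (∑ i, l i • (p i : Euc (n + 1))) (x : Euc (n + 1)) := by
  simp only [potential, sphChord, mul_sub, mul_one, Finset.sum_sub_distrib, hs, sum_inner,
    real_inner_smul_left]

lemma energy_sphChord {m : ℕ} {l : Fin m → ℝ} (hs : ∑ i, l i = 1) (p : Fin m → Sph n) :
    energy sphChord l p = 1 - ‖∑ i, l i • (p i : Euc (n + 1))‖ ^ 2 := by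
  rw [← real_inner_self_eq_norm_sq, inner_sum]
  simp only [energy, potential_sphChord hs, mul_sub, mul_one, Finset.sum_sub_distrib, hs,
    inner_smul_right]

/-- The energy is a mean of chords, so `1 - ‖w‖² ≤ 1 - cos D` for the weighted sum `w`; this allows
normalising `w` to a centre. -/
lemma sph_norm_pos {D : ℝ} (hD : 0 < Real.cos D) {m : ℕ} {l : Fin m → ℝ}
    (hl : l ∈ stdSimplex ℝ (Fin m)) (p : Fin m → Sph n)
    (hp : ∀ i j, sphChord (p i) (p j) ≤ 1 - Real.cos D) :
    0 < ‖∑ i, l i • (p i : Euc (n + 1))‖ := by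
  have h : energy sphChord l p ≤ 1 - Real.cos D := by
    have h1 : ∀ j, potential sphChord l p (p j) ≤ 1 - Real.cos D := fun j => by
      refine (Finset.sum_le_sum fun i _ => mul_le_mul_of_nonneg_left (hp i j) (hl.1 i)).trans ?_
      rw [← Finset.sum_mul, hl.2, one_mul]
    refine (Finset.sum_le_sum fun j _ => mul_le_mul_of_nonneg_left (h1 j) (hl.1 j)).trans ?_
    rw [← Finset.sum_mul, hl.2, one_mul]
  rw [energy_sphChord hl.2] at h
  have h2 : 0 < ‖∑ i, l i • (p i : Euc (n + 1))‖ ^ 2 := by linarith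
  exact lt_of_le_of_ne (norm_nonneg _) fun h3 => by rw [← h3] at h2; norm_num at h2

/-- Potential at most energy reads `⟨w, x⟩ ≥ ‖w‖²`, so the angle between `x` and `w / ‖w‖` has
cosine at least `‖w‖`. -/
lemma sph_exists_center {D : ℝ} (hD : 0 < Real.cos D) {m : ℕ} {l : Fin m → ℝ}
    (hl : l ∈ stdSimplex ℝ (Fin m)) (p : Fin m → Sph n)
    (hp : ∀ i j, sphChord (p i) (p j) ≤ 1 - Real.cos D) :
    ∃ z : Sph n, ∀ x, potential sphChord l p x ≤ energy sphChord l p →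
      sphDist x z ≤ Real.arccos √(1 - energy sphChord l p) := by
  have hw := sph_norm_pos hD hl p hp
  set w := ∑ i, l i • (p i : Euc (n + 1)) with hwdef
  refine ⟨⟨‖w‖⁻¹ • w, ?_⟩, fun x hx => ?_⟩
  · rw [mem_sphere_zero_iff_norm, norm_smul, norm_inv, norm_norm, inv_mul_cancel₀ hw.ne']
  · rw [potential_sphChord hl.2, energy_sphChord hl.2, ← hwdef] at hx
    rw [energy_sphChord hl.2, ← hwdef, sub_sub_cancel, Real.sqrt_sq hw.le, sphDist_eq_arccos]
    refine Real.arccos_le_arccos ?_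
    rw [real_inner_smul_right, real_inner_comm, inv_mul_eq_div, le_div_iff₀ hw]
    linarith

lemma sph_rad_le {m : ℕ} {l : Fin m → ℝ} (hl : l ∈ stdSimplex ℝ (Fin m)) (p : Fin m → Sph n)
    (z : Sph n) (R : ℝ) (h : ∀ i, sphDist (p i) z ≤ R) :
    Real.arccos √(1 - energy sphChord l p) ≤ R := by
  have hR : 0 ≤ R := by
    rcases m with _ | m
    · simpa using hl.2
    · exact (sphDist_nonneg _ _).trans (h 0)
  rcases le_total Real.pi R with hpi | hpi
  · exact (Real.arccos_le_pi _).trans hpi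
  set w := ∑ i, l i • (p i : Euc (n + 1)) with hwdef
  rw [energy_sphChord hl.2, sub_sub_cancel, Real.sqrt_sq (norm_nonneg _),
    ← Real.arccos_cos hR hpi]
  refine Real.arccos_le_arccos ?_
  calc Real.cos R = ∑ i, l i * Real.cos R := by rw [← Finset.sum_mul, hl.2, one_mul]
    _ ≤ ∑ i, l i * inner ℝ (p i : Euc (n + 1)) (z : Euc (n + 1)) :=
      Finset.sum_le_sum fun i _ =>
        mul_le_mul_of_nonneg_left ((sphDist_le_iff hR hpi).1 (h i)) (hl.1 i)
    _ = inner ℝ w (z : Euc (n + 1)) := by rw [hwdef, sum_inner]; simp [real_inner_smul_left]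
    _ ≤ ‖w‖ := by simpa [norm_coe_sph] using real_inner_le_norm w (z : Euc (n + 1))

/-- A linear dependence of `n + 2` vectors in dimension `n + 1` is automatically of total weight
zero: pair it with `w`, which has the same nonzero inner product with every point. -/
lemma sph_exists_dependence {D : ℝ} (hD : 0 < Real.cos D) {l : Fin (n + 2) → ℝ}
    (hl : l ∈ stdSimplex ℝ (Fin (n + 2))) (p : Fin (n + 2) → Sph n)
    (hp : ∀ i j, sphChord (p i) (p j) ≤ 1 - Real.cos D)
    (h : ∀ j, potential sphChord l p (p j) = energy sphChord l p) :
    ∃ a : Fin (n + 2) → ℝ, a ≠ 0 ∧ ∑ i, a i = 0 ∧ ∀ j, potential sphChord a p (p j) = 0 := by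
  have hdep : ¬ LinearIndependent ℝ fun i => (p i : Euc (n + 1)) := fun hli => by
    have := hli.fintype_card_le_finrank
    simp at this
  obtain ⟨a, ha, i, hi⟩ := Fintype.not_linearIndependent_iff.1 hdep
  have hw := sph_norm_pos hD hl p hp
  set w := ∑ i, l i • (p i : Euc (n + 1)) with hwdef
  have hpw : ∀ j, inner ℝ w (p j : Euc (n + 1)) = ‖w‖ ^ 2 := fun j => by
    have := h j
    rw [potential_sphChord hl.2, energy_sphChord hl.2] at this
    linarith
  have ha0 : ∑ i, a i = 0 := by
    have h1 : inner ℝ w (∑ i, a i • (p i : Euc (n + 1))) = 0 := by rw [ha, inner_zero_right]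
    simp only [inner_sum, inner_smul_right, hpw, ← Finset.sum_mul] at h1
    exact (mul_eq_zero.1 h1).resolve_right (by positivity)
  refine ⟨a, fun h0 => hi (by simp [h0]), ha0, fun j => ?_⟩
  have h2 : inner ℝ (∑ i, a i • (p i : Euc (n + 1))) (p j : Euc (n + 1)) = 0 := by
    rw [ha, inner_zero_left]
  simp only [sum_inner, real_inner_smul_left] at h2
  simp [potential, sphChord, mul_sub, Finset.sum_sub_distrib, ha0, h2]

lemma sph_ext_of_inner_eq_one {x y : Sph n}
    (h : inner ℝ (x : Euc (n + 1)) (y : Euc (n + 1)) = 1) : x = y :=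
  Subtype.ext ((inner_eq_one_iff_of_norm_eq_one (norm_coe_sph x) (norm_coe_sph y)).1 h)

lemma sph_exists_extension {D : ℝ} (hD : D < Real.pi / 2) {x z : Sph n} {r : ℝ} (hr : 0 ≤ r)
    (hrD : r ≤ D) (hxz : x ≠ z) (hd : sphDist x z ≤ D) :
    ∃ y : Sph n, sphDist y z ≤ r ∧ sphDist x z + r ≤ sphDist x y := by
  set a := sphDist x z with ha
  have ha0 : 0 < a := (sphDist_nonneg x z).lt_of_ne' fun h => hxz <| sph_ext_of_inner_eq_one <| by
    rw [← cos_sphDist, h, Real.cos_zero]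
  have hS : 0 < Real.sin a := Real.sin_pos_of_pos_of_lt_pi ha0 (by linarith)
  have hc : inner ℝ (x : Euc (n + 1)) (z : Euc (n + 1)) = Real.cos a := (cos_sphDist x z).symm
  have hc' : inner ℝ (z : Euc (n + 1)) (x : Euc (n + 1)) = Real.cos a := by
    rw [real_inner_comm, hc]
  have hsc := Real.sin_sq_add_cos_sq a
  have hsc' := Real.sin_sq_add_cos_sq r
  -- The point `y = (sin (a + r) z - sin r x) / sin a` lies on the great circle from `x` through
  -- `z`, at distance `r` beyond `z`.
  set β := Real.sin r / Real.sin a with hβ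
  have hβ' : β * Real.sin a = Real.sin r := div_mul_cancel₀ _ hS.ne'
  set α := Real.cos r + β * Real.cos a with hα
  set y : Euc (n + 1) := α • (z : Euc (n + 1)) - β • (x : Euc (n + 1)) with hy
  have hyz : inner ℝ y (z : Euc (n + 1)) = Real.cos r := by
    rw [hy, inner_sub_left, real_inner_smul_left, real_inner_smul_left, inner_coe_self_sph, hc, hα]
    ring
  have hxy : inner ℝ (x : Euc (n + 1)) y = Real.cos (a + r) := by
    rw [hy, inner_sub_right, real_inner_smul_right, real_inner_smul_right, inner_coe_self_sph, hc,
      Real.cos_add, ← hβ', hα]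
    linear_combination β * hsc
  have hyy : ‖y‖ = 1 := by
    have h : inner ℝ y y = 1 := by
      nth_rw 2 [hy]
      rw [inner_sub_right, real_inner_smul_right, real_inner_smul_right, hyz,
        real_inner_comm, hxy, Real.cos_add, ← hβ', hα]
      rw [← hβ'] at hsc'
      linear_combination hsc'
    rw [real_inner_self_eq_norm_sq] at h
    nlinarith [norm_nonneg y]
  refine ⟨⟨y, mem_sphere_zero_iff_norm.2 hyy⟩, ?_, ?_⟩
  · rw [sphDist_le_iff hr (by linarith)]
    exact hyz.ge
  · rw [sphDist_eq_arccos x ⟨y, _⟩]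
    change a + r ≤ Real.arccos (inner ℝ (x : Euc (n + 1)) y)
    rw [hxy, Real.arccos_cos (by linarith) (by linarith)]

lemma sph_exists_reflection (x y : Sph n) : ∃ σ : Sph n ≃ Sph n,
    (∀ a b, sphDist (σ a) (σ b) = sphDist a b) ∧ σ x = y ∧
      ∀ z, sphDist z x = sphDist z y → σ z = z := by
  set T := (Submodule.span ℝ {(x : Euc (n + 1)) - y})ᗮ.reflection with hT
  refine ⟨T.toEquiv.subtypeEquiv fun a => ?_, fun a b => ?_, ?_, fun z hz => ?_⟩
  · rw [mem_sphere_zero_iff_norm, mem_sphere_zero_iff_norm]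
    change _ ↔ ‖T a‖ = 1
    rw [T.norm_map]
  · change 2 * Real.arcsin (dist (T a) (T b) / 2) = _
    rw [T.dist_map, sphDist]
  · refine Subtype.ext ?_
    change T x = y
    exact Submodule.reflection_sub ((norm_coe_sph x).trans (norm_coe_sph y).symm)
  · refine Subtype.ext ?_
    change T z = z
    refine Submodule.reflection_mem_subspace_eq_self ?_
    rw [Submodule.mem_orthogonal_singleton_iff_inner_right, inner_sub_left, real_inner_comm,
      ← cos_sphDist, hz, cos_sphDist, real_inner_comm, sub_self]

/-- On the segment `sin t q = sin (t - s) x + sin s y`, with coefficients of sum at least `sin t`.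
As `cos R ≥ 0` for `R < π / 2`, the bound on cosines passes to `q`. -/
lemma sphSegment_subset {D : ℝ} (hD : D < Real.pi / 2) {z x y : Sph n} {R : ℝ} (hR : R ≤ D)
    (hx : sphDist x z ≤ R) (hy : sphDist y z ≤ R) :
    sphSegment x y ⊆ {q | sphDist q z ≤ R} := by
  rintro q ⟨u, t, s, -, -, hs, hst, htpi, hyu, hqu⟩
  have hR0 : 0 ≤ R := (sphDist_nonneg x z).trans hx
  have hRpi : R ≤ Real.pi := by linarith [Real.pi_pos]
  have hcos : 0 ≤ Real.cos R := Real.cos_nonneg_of_neg_pi_div_two_le_of_le (by linarith)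
    (by linarith)
  rw [sphDist_le_iff hR0 hRpi] at hx hy
  change sphDist q z ≤ R
  rw [sphDist_le_iff hR0 hRpi]
  rcases (hs.trans hst).eq_or_lt with ht | ht
  · have hs0 : s = 0 := by linarith
    rw [hqu, hs0]
    simpa using hx
  · have hS : 0 < Real.sin t := Real.sin_pos_of_pos_of_lt_pi ht htpi
    have hs1 : 0 ≤ Real.sin s := Real.sin_nonneg_of_nonneg_of_le_pi hs (by linarith)
    have hs2 : 0 ≤ Real.sin (t - s) :=
      Real.sin_nonneg_of_nonneg_of_le_pi (by linarith) (by linarith)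
    have key : Real.sin t * inner ℝ (q : Euc (n + 1)) (z : Euc (n + 1))
        = Real.sin (t - s) * inner ℝ (x : Euc (n + 1)) (z : Euc (n + 1))
          + Real.sin s * inner ℝ (y : Euc (n + 1)) (z : Euc (n + 1)) := by
      rw [hqu, hyu, inner_add_left, inner_add_left]
      simp only [real_inner_smul_left]
      rw [Real.sin_sub]
      ring
    have hsum : Real.sin t ≤ Real.sin (t - s) + Real.sin s := by
      have h1 : Real.sin t = Real.sin (t - s) * Real.cos s + Real.cos (t - s) * Real.sin s := by
        rw [← Real.sin_add, sub_add_cancel]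
      rw [h1]
      exact add_le_add (mul_le_of_le_one_right hs2 (Real.cos_le_one _))
        (mul_le_of_le_one_left hs1 (Real.cos_le_one _))
    have h2 := mul_le_mul_of_nonneg_left hx hs2
    have h3 := mul_le_mul_of_nonneg_left hy hs1
    have h4 := mul_le_mul_of_nonneg_right hsum hcos
    refine le_of_mul_le_mul_left ?_ hS
    rw [key]
    linarith

lemma sph_exists_simplex {D : ℝ} (hD0 : 0 ≤ D) (hD : D < Real.pi / 2) :
    ∃ v : Fin (n + 1) → Sph n, ∀ i j, i ≠ j → sphDist (v i) (v j) = D := by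
  have hc : 0 < Real.cos D := Real.cos_pos_of_mem_Ioo ⟨by linarith, hD⟩
  set c := Real.cos D with hcdef
  set a := √(1 - c) with ha
  have ha2 : a ^ 2 = 1 - c := Real.sq_sqrt (by linarith [Real.cos_le_one D])
  -- The vertices are `a e_i + (b, …, b)` in `ℝⁿ⁺¹`; `a² = 1 - c` and `(n + 1)b² + 2ab = c` give
  -- norm 1 and mutual inner products `c`.
  set b := (√(a ^ 2 + (n + 1) * c) - a) / (n + 1) with hb
  have hb2 : (n + 1) * b ^ 2 + 2 * a * b = c := by
    have h := Real.sq_sqrt (show (0 : ℝ) ≤ a ^ 2 + (n + 1) * c by positivity)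
    have h1 : (n + 1) * b = √(a ^ 2 + (n + 1) * c) - a := by rw [hb]; field_simp
    have h2 : ((n : ℝ) + 1) * ((n + 1) * b ^ 2 + 2 * a * b - c) = 0 := by
      have : ((n : ℝ) + 1) * ((n + 1) * b ^ 2 + 2 * a * b - c)
          = ((n + 1) * b) ^ 2 + 2 * a * ((n + 1) * b) - (n + 1) * c := by ring
      rw [this, h1]
      linear_combination h
    have h3 := (mul_eq_zero.1 h2).resolve_left (by positivity)
    linarith
  set e : Euc (n + 1) := WithLp.toLp 2 fun _ => b with he
  have hee : inner ℝ e e = (n + 1) * b ^ 2 := by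
    rw [real_inner_self_eq_norm_sq, EuclideanSpace.real_norm_sq_eq]
    simp [he]
  have hinner : ∀ i j : Fin (n + 1),
      inner ℝ (EuclideanSpace.single i a + e) (EuclideanSpace.single j a + e)
        = (if i = j then a ^ 2 else 0) + c := fun i j => by
    rw [inner_add_left, inner_add_right, inner_add_right, real_inner_comm _ e, hee,
      EuclideanSpace.inner_single_left, EuclideanSpace.inner_single_left,
      EuclideanSpace.inner_single_left]
    simp only [he, PiLp.single_apply, conj_trivial]
    split_ifs
    · rw [← hb2]; ring
    · rw [← hb2]; ring
  have hnorm : ∀ i : Fin (n + 1), ‖EuclideanSpace.single i a + e‖ = 1 := fun i => by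
    have h := hinner i i
    rw [real_inner_self_eq_norm_sq, if_pos rfl, ha2, sub_add_cancel] at h
    nlinarith [norm_nonneg (EuclideanSpace.single i a + e)]
  refine ⟨fun i => ⟨_, mem_sphere_zero_iff_norm.2 (hnorm i)⟩, fun i j hij => ?_⟩
  rw [sphDist_eq_arccos]
  change Real.arccos (inner ℝ (EuclideanSpace.single i a + e) (EuclideanSpace.single j a + e)) = D
  rw [hinner, if_neg hij, zero_add, hcdef, Real.arccos_cos hD0 (by linarith [Real.pi_pos])]

instance : TopologicalSpace (Space .spherical n) := inferInstanceAs (TopologicalSpace (Sph n))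

lemma jungSpace_spherical {D : ℝ} (hD : 0 < D) (hD2 : D < Real.pi / 2) :
    JungSpace .spherical n D (1 - Real.cos D) (sphChord (n := n))
      (fun e => Real.arccos √(1 - e)) := by
  have hc : 0 < Real.cos D := Real.cos_pos_of_mem_Ioo ⟨by linarith, hD2⟩
  have hDpi : D ≤ Real.pi := by linarith [Real.pi_pos]
  have hself : ∀ x : Sph n, sphDist x x = 0 := fun x => by simp [sphDist]
  have hcomm : ∀ x y : Sph n, sphDist x y = sphDist y x := fun x y => by
    rw [sphDist, dist_comm, sphDist]
  have htri : ∀ x y z : Sph n, sphDist x z ≤ sphDist x y + sphDist y z := fun x y z => by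
    simp only [sphDist_eq_angle]
    exact InnerProductGeometry.angle_le_angle_add_angle _ _ _
  have hccont : Continuous fun q : Sph n × Sph n => sphChord q.1 q.2 := by
    unfold sphChord
    fun_prop
  have hccomm : ∀ x y : Sph n, sphChord x y = sphChord y x := fun x y => by
    rw [sphChord, real_inner_comm, sphChord]
  have hcself : ∀ x : Sph n, sphChord x x = 0 := fun x => by
    rw [sphChord, inner_coe_self_sph, sub_self]
  have hcos : ∀ x y : Sph n, sphChord x y = 1 - Real.cos (sphDist x y) := fun x y => by
    rw [cos_sphDist, sphChord]
  have hcnn : ∀ x y : Sph n, 0 ≤ sphChord x y := fun x y => by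
    rw [hcos]; linarith [Real.cos_le_one (sphDist x y)]
  have hcle : ∀ x y : Sph n, sphChord x y ≤ 1 - Real.cos D ↔ sphDist x y ≤ D := fun x y => by
    rw [sphDist_le_iff hD.le hDpi, sphChord, sub_le_sub_iff_left]
  have hceq : ∀ x y : Sph n, sphChord x y = 1 - Real.cos D → sphDist x y = D := fun x y h => by
    rw [hcos, sub_right_inj] at h
    exact Real.injOn_cos ⟨sphDist_nonneg x y, sphDist_le_pi x y⟩ ⟨hD.le, hDpi⟩ h
  have hceq' : ∀ x y : Sph n, sphDist x y = D → sphChord x y = 1 - Real.cos D := fun x y h => by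
    rw [hcos, h]
  have hball : ∀ z : Sph n, IsCompact {x : Sph n | sphDist x z ≤ D} := fun z => by
    refine IsClosed.isCompact (isClosed_le ?_ continuous_const)
    unfold sphDist
    exact continuous_const.mul (Real.continuous_arcsin.comp (by fun_prop))
  have hhemi : ∀ (z : Sph n) (X : Set (Sph n)), X ⊆ {x | sphDist x z ≤ D} →
      ∃ w : Sph n, ∀ x ∈ X, 0 < inner ℝ (w : Euc (n + 1)) (x : Euc (n + 1)) := by
    refine fun z X hX => ⟨z, fun x hx => ?_⟩
    rw [real_inner_comm]
    exact hc.trans_le ((sphDist_le_iff hD.le hDpi).1 (hX hx))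
  exact
  { D_pos := hD
    H_pos := by
      have := Real.cos_lt_cos_of_nonneg_of_le_pi le_rfl hDpi hD
      rw [Real.cos_zero] at this
      linarith
    dist_self := hself
    dist_comm := hcomm
    dist_triangle := htri
    continuous_chord := hccont
    chord_comm := hccomm
    chord_self := hcself
    chord_nonneg := hcnn
    chord_le_iff := hcle
    dist_eq_of_chord_eq := hceq
    chord_eq_of_dist_eq := hceq'
    isCompact_ball := hball
    rad_nonneg := fun e _ => Real.arccos_nonneg _
    rad_strictMono := fun a ha b hb hab => by
      have h0 : ∀ e ∈ Set.Icc 0 (1 - Real.cos D), √(1 - e) ∈ Set.Icc (-1 : ℝ) 1 := fun e he =>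
        ⟨by linarith [Real.sqrt_nonneg (1 - e)], Real.sqrt_le_one.2 (by linarith [he.1])⟩
      exact Real.strictAntiOn_arccos (h0 b hb) (h0 a ha)
        (Real.sqrt_lt_sqrt (by linarith [hb.2]) (by linarith))
    exists_center := fun m l p hl hp => sph_exists_center hc hl p hp
    rad_le := fun m l p hl _ z R h => sph_rad_le hl p z R h
    exists_dependence := fun l p hl hp h => sph_exists_dependence hc hl p hp h
    exists_extension := fun x z r hr hrD hxz hd => sph_exists_extension hD2 hr hrD hxz hd
    exists_reflection := fun x y _ => sph_exists_reflection x y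
    hemisphereCondition := hhemi
    geodSegment_subset := fun z R hR x hx y hy => sphSegment_subset hD2 hR hx hy
    exists_simplex := sph_exists_simplex hD.le hD2 }

end Spherical

/-! ### Hyperbolic space -/

section Hyperbolic

lemma lorentz_eq_inner (x y : Euc (n + 1)) : lorentz x y = 2 * (x 0 * y 0) - inner ℝ x y := by
  rw [lorentz, PiLp.inner_apply, Fin.sum_univ_succ]
  simp only [RCLike.inner_apply, conj_trivial, mul_comm (y _)]
  ring

lemma lorentz_comm (x y : Euc (n + 1)) : lorentz x y = lorentz y x := by
  rw [lorentz_eq_inner, lorentz_eq_inner, real_inner_comm, mul_comm (x 0)]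

lemma lorentz_add_left (x y z : Euc (n + 1)) :
    lorentz (x + y) z = lorentz x z + lorentz y z := by
  simp only [lorentz_eq_inner, inner_add_left, PiLp.add_apply]
  ring

lemma lorentz_smul_left (a : ℝ) (x y : Euc (n + 1)) : lorentz (a • x) y = a * lorentz x y := by
  simp only [lorentz_eq_inner, real_inner_smul_left, PiLp.smul_apply, smul_eq_mul]
  ring

lemma lorentz_sub_left (x y z : Euc (n + 1)) :
    lorentz (x - y) z = lorentz x z - lorentz y z := by
  simp only [lorentz_eq_inner, inner_sub_left, PiLp.sub_apply]
  ring

lemma lorentz_add_right (x y z : Euc (n + 1)) :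
    lorentz x (y + z) = lorentz x y + lorentz x z := by
  simp only [lorentz_comm x, lorentz_add_left]

lemma lorentz_smul_right (a : ℝ) (x y : Euc (n + 1)) : lorentz x (a • y) = a * lorentz x y := by
  simp only [lorentz_comm x, lorentz_smul_left]

lemma lorentz_sub_right (x y z : Euc (n + 1)) :
    lorentz x (y - z) = lorentz x y - lorentz x z := by
  simp only [lorentz_comm x, lorentz_sub_left]

lemma lorentz_sum_left {m : ℕ} (f : Fin m → Euc (n + 1)) (y : Euc (n + 1)) :
    lorentz (∑ i, f i) y = ∑ i, lorentz (f i) y := by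
  simp only [lorentz_eq_inner, sum_inner, Finset.sum_sub_distrib, ← Finset.mul_sum,
    ← Finset.sum_mul]
  simp

lemma continuous_lorentz : Continuous fun q : Euc (n + 1) × Euc (n + 1) => lorentz q.1 q.2 := by
  simp only [lorentz_eq_inner]
  fun_prop

/-- The Cauchy-Schwarz inequality for the spacelike parts. -/
lemma lorentz_cauchy (x y : Euc (n + 1)) :
    (x 0 * y 0 - lorentz x y) ^ 2 ≤ (x 0 ^ 2 - lorentz x x) * (y 0 ^ 2 - lorentz y y) := by
  have h := Finset.sum_mul_sq_le_sq_mul_sq Finset.univ (fun i : Fin n => x i.succ)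
    fun i => y i.succ
  have h1 : ∀ z : Euc (n + 1), z 0 ^ 2 - lorentz z z = ∑ i : Fin n, z i.succ ^ 2 := fun z => by
    simp only [lorentz, ← sq]; ring
  rw [h1, h1, lorentz, sub_sub_cancel]
  exact h

lemma lorentz_self_le (x : Euc (n + 1)) : lorentz x x ≤ x 0 ^ 2 := by
  have : 0 ≤ ∑ i : Fin n, x i.succ * x i.succ := Finset.sum_nonneg fun i _ => mul_self_nonneg _
  rw [lorentz, sq]
  linarith

/-- Reversed Cauchy-Schwarz, from `(x₀² - 1)(y₀² - 1) = (x₀y₀ - 1)² - (x₀ - y₀)²`. -/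
lemma one_le_lorentz {x y : Euc (n + 1)} (hx0 : 1 ≤ x 0) (hx : lorentz x x = 1) (hy0 : 1 ≤ y 0)
    (hy : lorentz y y = 1) : 1 ≤ lorentz x y := by
  have h := lorentz_cauchy x y
  rw [hx, hy] at h
  have h1 : (x 0 * y 0 - lorentz x y) ^ 2 ≤ (x 0 * y 0 - 1) ^ 2 := by
    nlinarith [sq_nonneg (x 0 - y 0)]
  have h2 := abs_le_of_sq_le_sq h1 (by nlinarith)
  linarith [(abs_le.1 h2).2]

lemma one_le_lorentz_coe (x y : Hyp n) : 1 ≤ lorentz (x : Euc (n + 1)) (y : Euc (n + 1)) :=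
  one_le_lorentz x.2.1 x.2.2 y.2.1 y.2.2

/-- Were `u` on the lower sheet, `-u` would be on the upper one and pair positively with `y`. -/
lemma one_le_of_lorentz_pos {u : Euc (n + 1)} (hu : lorentz u u = 1) {y : Hyp n}
    (h : 0 < lorentz u (y : Euc (n + 1))) : 1 ≤ u 0 := by
  have h1 : 1 ≤ u 0 ^ 2 := hu ▸ lorentz_self_le u
  by_contra! hlt
  have h2 : u 0 ≤ -1 := by
    by_contra! h3
    nlinarith
  have h3 := one_le_lorentz (x := (-1 : ℝ) • u) (y := (y : Euc (n + 1))) (by simp; linarith)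
    (by rw [lorentz_smul_left, lorentz_smul_right, hu]; norm_num) y.2.1 y.2.2
  rw [lorentz_smul_left] at h3
  linarith

lemma hyp_ext_of_lorentz_eq_one {x y : Hyp n}
    (h : lorentz (x : Euc (n + 1)) (y : Euc (n + 1)) = 1) : x = y := by
  have hc := lorentz_cauchy (x : Euc (n + 1)) (y : Euc (n + 1))
  rw [x.2.2, y.2.2, h] at hc
  have h0 : (x : Euc (n + 1)) 0 - (y : Euc (n + 1)) 0 = 0 := by
    have : ((x : Euc (n + 1)) 0 - (y : Euc (n + 1)) 0) ^ 2 ≤ 0 := by nlinarith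
    nlinarith [sq_nonneg ((x : Euc (n + 1)) 0 - (y : Euc (n + 1)) 0)]
  have h1 : inner ℝ ((x : Euc (n + 1)) - (y : Euc (n + 1)))
      ((x : Euc (n + 1)) - (y : Euc (n + 1))) = 0 := by
    have h2 : lorentz ((x : Euc (n + 1)) - (y : Euc (n + 1)))
      ((x : Euc (n + 1)) - (y : Euc (n + 1))) = 0 := by
      simp only [lorentz_sub_left, lorentz_sub_right, x.2.2, y.2.2, lorentz_comm (y : Euc (n + 1)),
        h]
      ring
    rw [lorentz_eq_inner, PiLp.sub_apply, h0] at h2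
    linarith
  exact Subtype.ext (sub_eq_zero.1 (inner_self_eq_zero.1 h1))

/-- The orthogonal complement of a timelike vector is spacelike. -/
lemma lorentz_self_nonpos {y : Hyp n} {u : Euc (n + 1)} (h : lorentz (y : Euc (n + 1)) u = 0) :
    lorentz u u ≤ 0 := by
  have hc := lorentz_cauchy (y : Euc (n + 1)) u
  rw [y.2.2, h] at hc
  have h1 := lorentz_self_le u
  have h2 : (y : Euc (n + 1)) 0 ^ 2 * lorentz u u ≤ 0 := by linarith
  exact nonpos_of_mul_nonpos_right h2 (pow_pos (zero_lt_one.trans_le y.2.1) 2)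

lemma cosh_hypDist (x y : Hyp n) :
    Real.cosh (hypDist x y) = lorentz (x : Euc (n + 1)) (y : Euc (n + 1)) :=
  Real.cosh_arcosh (one_le_lorentz_coe x y)

lemma hypDist_nonneg (x y : Hyp n) : 0 ≤ hypDist x y := Real.arcosh_nonneg (one_le_lorentz_coe x y)

lemma hypDist_le_iff {x y : Hyp n} {R : ℝ} (hR : 0 ≤ R) :
    hypDist x y ≤ R ↔ lorentz (x : Euc (n + 1)) (y : Euc (n + 1)) ≤ Real.cosh R := by
  rw [← cosh_hypDist, Real.cosh_le_cosh, abs_of_nonneg (hypDist_nonneg x y), abs_of_nonneg hR]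

lemma hypDist_comm (x y : Hyp n) : hypDist x y = hypDist y x := by
  rw [hypDist, lorentz_comm, hypDist]

lemma hypDist_self (x : Hyp n) : hypDist x x = 0 := by
  rw [hypDist, x.2.2, Real.arcosh_eq_zero_iff le_rfl]

lemma hyp_ext_of_hypDist_eq_zero {x y : Hyp n} (h : hypDist x y = 0) : x = y :=
  hyp_ext_of_lorentz_eq_one <| by rw [← cosh_hypDist, h, Real.cosh_zero]

lemma hypDist_triangle (x y z : Hyp n) : hypDist x z ≤ hypDist x y + hypDist y z := by
  rcases (hypDist_nonneg x y).eq_or_lt with h | ha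
  · rw [hyp_ext_of_hypDist_eq_zero h.symm, hypDist_self, zero_add]
  rcases (hypDist_nonneg y z).eq_or_lt with h | hb
  · rw [hyp_ext_of_hypDist_eq_zero h.symm, hypDist_self, add_zero]
  rw [hypDist_le_iff (by linarith), Real.cosh_add]
  have hP := cosh_hypDist x y
  have hQ := cosh_hypDist y z
  set a := hypDist x y
  set b := hypDist y z
  have hsa := Real.sinh_pos_iff.2 ha
  have hsb := Real.sinh_pos_iff.2 hb
  have hca := Real.cosh_sq a
  have hcb := Real.cosh_sq b
  -- The components of `x` and `z` orthogonal to `y`, scaled to equal length and added. That `u` is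
  -- not timelike says exactly `B(x, z) ≤ cosh (a + b)`.
  set u : Euc (n + 1) := Real.sinh b • ((x : Euc (n + 1)) - Real.cosh a • (y : Euc (n + 1)))
    + Real.sinh a • ((z : Euc (n + 1)) - Real.cosh b • (y : Euc (n + 1))) with hu
  have hyu : lorentz (y : Euc (n + 1)) u = 0 := by
    simp only [hu, lorentz_add_right, lorentz_smul_right, lorentz_sub_right, y.2.2, ← hQ,
      lorentz_comm (y : Euc (n + 1)) x, ← hP]
    ring
  have huu := lorentz_self_nonpos hyu
  have hval : lorentz u u = 2 * (Real.sinh a * Real.sinh b) *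
      (lorentz (x : Euc (n + 1)) (z : Euc (n + 1)) - Real.cosh a * Real.cosh b
        - Real.sinh a * Real.sinh b) := by
    simp only [hu, lorentz_add_right, lorentz_smul_right, lorentz_sub_right, lorentz_add_left,
      lorentz_smul_left, lorentz_sub_left, y.2.2, x.2.2, z.2.2, ← hQ,
      lorentz_comm (y : Euc (n + 1)) x, lorentz_comm (z : Euc (n + 1)), ← hP]
    linear_combination (-Real.sinh b ^ 2) * hca - Real.sinh a ^ 2 * hcb
  rw [hval] at huu
  have h0 : 0 < 2 * (Real.sinh a * Real.sinh b) := by positivity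
  have := nonpos_of_mul_nonpos_right huu h0
  linarith

lemma hyp_isCompact_ball (z : Hyp n) (c : ℝ) :
    IsCompact {x : Hyp n | lorentz (x : Euc (n + 1)) (z : Euc (n + 1)) ≤ c} := by
  rw [Subtype.isCompact_iff]
  have himg : ((↑) : Hyp n → Euc (n + 1)) ''
      {x : Hyp n | lorentz (x : Euc (n + 1)) (z : Euc (n + 1)) ≤ c}
        = {x | 1 ≤ x 0} ∩ {x | lorentz x x = 1} ∩ {x | lorentz x (z : Euc (n + 1)) ≤ c} := by
    ext x
    constructor
    · rintro ⟨y, hy, rfl⟩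
      exact ⟨⟨y.2.1, y.2.2⟩, hy⟩
    · rintro ⟨⟨h0, h1⟩, h2⟩
      exact ⟨⟨x, h0, h1⟩, h2, rfl⟩
  rw [himg]
  refine Metric.isCompact_of_isClosed_isBounded ?_ ?_
  · refine ((isClosed_le continuous_const (by fun_prop)).inter (isClosed_eq ?_
      continuous_const)).inter (isClosed_le ?_ continuous_const)
    · exact continuous_lorentz.comp (by fun_prop : Continuous fun x : Euc (n + 1) => (x, x))
    · exact continuous_lorentz.comp
        (by fun_prop : Continuous fun x : Euc (n + 1) => (x, (z : Euc (n + 1))))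
  · set t := (z : Euc (n + 1)) 0 with ht
    have ht1 : 1 ≤ t := z.2.1
    -- `q` is the length of the spacelike part of `z`. Cauchy-Schwarz yields `x₀ (t - q) ≤ c`, and
    -- `q < t`, so `x₀` is bounded.
    set q := √(t ^ 2 - 1) with hq
    have hq2 : q ^ 2 = t ^ 2 - 1 := Real.sq_sqrt (by nlinarith)
    have hq0 : 0 ≤ q := Real.sqrt_nonneg _
    have hqt : 0 < t - q := by nlinarith
    refine (Metric.isBounded_closedBall (x := (0 : Euc (n + 1)))
      (r := 2 * (c / (t - q)))).subset ?_
    rintro x ⟨⟨h0, h1⟩, h2⟩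
    have h0' : 1 ≤ x 0 := h0
    have h1' : lorentz x x = 1 := h1
    have h2' : lorentz x (z : Euc (n + 1)) ≤ c := h2
    have hc := lorentz_cauchy x (z : Euc (n + 1))
    rw [h1', z.2.2, ← ht, ← hq2] at hc
    have h3 : (x 0 * t - lorentz x (z : Euc (n + 1))) ^ 2 ≤ (x 0 * q) ^ 2 := by
      nlinarith [sq_nonneg q]
    have h4 := (abs_le.1 (abs_le_of_sq_le_sq h3 (by positivity))).2
    have h5 : x 0 ≤ c / (t - q) := by
      rw [le_div_iff₀ hqt]
      linarith
    rw [mem_closedBall_zero_iff]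
    have h6 : ‖x‖ ^ 2 = 2 * x 0 ^ 2 - 1 := by
      rw [lorentz_eq_inner, real_inner_self_eq_norm_sq] at h1'
      linarith
    have h7 : ‖x‖ ≤ 2 * x 0 := by
      refine le_of_sq_le_sq ?_ (by linarith)
      rw [h6]
      nlinarith
    linarith

/-- The chord function `B(x, y) - 1` of `Hⁿ`. -/
noncomputable def hypChord (x y : Hyp n) : ℝ := lorentz (x : Euc (n + 1)) (y : Euc (n + 1)) - 1

lemma hypChord_nonneg (x y : Hyp n) : 0 ≤ hypChord x y := sub_nonneg.2 (one_le_lorentz_coe x y)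

lemma potential_hypChord {m : ℕ} {l : Fin m → ℝ} (hs : ∑ i, l i = 1) (p : Fin m → Hyp n)
    (x : Hyp n) : potential hypChord l p x
      = lorentz (∑ i, l i • (p i : Euc (n + 1))) (x : Euc (n + 1)) - 1 := by
  simp only [potential, hypChord, mul_sub, mul_one, Finset.sum_sub_distrib, hs, lorentz_sum_left,
    lorentz_smul_left]

lemma energy_hypChord {m : ℕ} {l : Fin m → ℝ} (hs : ∑ i, l i = 1) (p : Fin m → Hyp n) :
    energy hypChord l p
      = lorentz (∑ i, l i • (p i : Euc (n + 1))) (∑ i, l i • (p i : Euc (n + 1))) - 1 := by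
  rw [lorentz_sum_left]
  simp only [energy, potential_hypChord hs, mul_sub, mul_one, Finset.sum_sub_distrib, hs,
    lorentz_smul_left]
  simp only [lorentz_comm (∑ i, l i • (p i : Euc (n + 1)))]

/-- The weighted sum `w` has `B(w, w) = 1 + energy > 0`, and it lies on the side of the upper sheet
because it pairs positively with one of the points. -/
lemma exists_hyp_normalize {m : ℕ} {l : Fin m → ℝ} (hl : l ∈ stdSimplex ℝ (Fin m))
    (p : Fin m → Hyp n) : ∃ z : Hyp n, ∑ i, l i • (p i : Euc (n + 1))
      = √(1 + energy hypChord l p) • (z : Euc (n + 1)) := by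
  set w := ∑ i, l i • (p i : Euc (n + 1)) with hw
  have he0 : 0 ≤ energy hypChord l p := energy_nonneg hypChord_nonneg hl.1 p
  have he : 1 + energy hypChord l p = lorentz w w := by rw [energy_hypChord hl.2]; ring
  set r := √(1 + energy hypChord l p) with hr
  have hr0 : 0 < r := Real.sqrt_pos.2 (by linarith)
  have hr2 : r ^ 2 = lorentz w w := by rw [hr, Real.sq_sqrt (by linarith), he]
  have hu : lorentz (r⁻¹ • w) (r⁻¹ • w) = 1 := by
    rw [lorentz_smul_left, lorentz_smul_right, ← hr2]
    field_simp
  have hm : m ≠ 0 := by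
    rintro rfl
    simpa using hl.2
  have hpos : 0 < lorentz (r⁻¹ • w) (p ⟨0, Nat.pos_of_ne_zero hm⟩ : Euc (n + 1)) := by
    rw [lorentz_smul_left]
    refine mul_pos (inv_pos.2 hr0) ?_
    have h := potential_hypChord hl.2 p (p ⟨0, Nat.pos_of_ne_zero hm⟩)
    have h1 : 0 ≤ potential hypChord l p (p ⟨0, Nat.pos_of_ne_zero hm⟩) :=
      Finset.sum_nonneg fun i _ => mul_nonneg (hl.1 i) (hypChord_nonneg _ _)
    rw [← hw] at h
    linarith
  refine ⟨⟨r⁻¹ • w, one_le_of_lorentz_pos hu hpos, hu⟩, ?_⟩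
  change w = r • r⁻¹ • w
  rw [smul_inv_smul₀ hr0.ne']

lemma hyp_exists_center {m : ℕ} {l : Fin m → ℝ} (hl : l ∈ stdSimplex ℝ (Fin m))
    (p : Fin m → Hyp n) :
    ∃ z : Hyp n, ∀ x, potential hypChord l p x ≤ energy hypChord l p →
      hypDist x z ≤ Real.arcosh √(1 + energy hypChord l p) := by
  obtain ⟨z, hz⟩ := exists_hyp_normalize hl p
  refine ⟨z, fun x hx => ?_⟩
  have he0 : 0 ≤ energy hypChord l p := energy_nonneg hypChord_nonneg hl.1 p
  rw [potential_hypChord hl.2, hz, lorentz_smul_left] at hx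
  set r := √(1 + energy hypChord l p) with hr
  have hr0 : 0 < r := Real.sqrt_pos.2 (by linarith)
  have hr2 : r ^ 2 = 1 + energy hypChord l p := Real.sq_sqrt (by linarith)
  rw [hypDist, Real.arcosh_le_arcosh (zero_lt_one.trans_le (one_le_lorentz_coe x z)) hr0,
    lorentz_comm]
  nlinarith

lemma hyp_rad_le {m : ℕ} {l : Fin m → ℝ} (hl : l ∈ stdSimplex ℝ (Fin m)) (p : Fin m → Hyp n)
    (z : Hyp n) (R : ℝ) (h : ∀ i, hypDist (p i) z ≤ R) :
    Real.arcosh √(1 + energy hypChord l p) ≤ R := by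
  have hR : 0 ≤ R := by
    rcases m with _ | m
    · simpa using hl.2
    · exact (hypDist_nonneg _ _).trans (h 0)
  have he0 : 0 ≤ energy hypChord l p := energy_nonneg hypChord_nonneg hl.1 p
  obtain ⟨c, hc⟩ := exists_hyp_normalize hl p
  have hr0 : 0 < √(1 + energy hypChord l p) := Real.sqrt_pos.2 (by linarith)
  rw [← Real.arcosh_cosh hR, Real.arcosh_le_arcosh hr0 (Real.cosh_pos R)]
  calc √(1 + energy hypChord l p)
      ≤ √(1 + energy hypChord l p) * lorentz (c : Euc (n + 1)) (z : Euc (n + 1)) :=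
        le_mul_of_one_le_right hr0.le (one_le_lorentz_coe c z)
    _ = ∑ i, l i * lorentz (p i : Euc (n + 1)) (z : Euc (n + 1)) := by
        rw [← lorentz_smul_left, ← hc, lorentz_sum_left]
        simp only [lorentz_smul_left]
    _ ≤ ∑ i, l i * Real.cosh R := Finset.sum_le_sum fun i _ =>
        mul_le_mul_of_nonneg_left ((hypDist_le_iff hR).1 (h i)) (hl.1 i)
    _ = Real.cosh R := by rw [← Finset.sum_mul, hl.2, one_mul]

lemma hyp_exists_dependence {l : Fin (n + 2) → ℝ} (hl : l ∈ stdSimplex ℝ (Fin (n + 2)))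
    (p : Fin (n + 2) → Hyp n) (h : ∀ j, potential hypChord l p (p j) = energy hypChord l p) :
    ∃ a : Fin (n + 2) → ℝ, a ≠ 0 ∧ ∑ i, a i = 0 ∧ ∀ j, potential hypChord a p (p j) = 0 := by
  have hdep : ¬ LinearIndependent ℝ fun i => (p i : Euc (n + 1)) := fun hli => by
    have := hli.fintype_card_le_finrank
    simp at this
  obtain ⟨a, ha, i, hi⟩ := Fintype.not_linearIndependent_iff.1 hdep
  have hzero : ∀ y : Euc (n + 1), ∑ i, a i * lorentz (p i : Euc (n + 1)) y = 0 := fun y => by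
    have h1 : lorentz (∑ i, a i • (p i : Euc (n + 1))) y = 0 := by
      rw [ha, ← zero_smul ℝ (0 : Euc (n + 1)), lorentz_smul_left, zero_mul]
    simpa only [lorentz_sum_left, lorentz_smul_left] using h1
  have he0 : 0 ≤ energy hypChord l p := energy_nonneg hypChord_nonneg hl.1 p
  set w := ∑ i, l i • (p i : Euc (n + 1)) with hwdef
  have hpw : ∀ j, lorentz (p j : Euc (n + 1)) w = energy hypChord l p + 1 := fun j => by
    rw [← h j, potential_hypChord hl.2, lorentz_comm]
    ring
  have ha0 : ∑ i, a i = 0 := by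
    have h1 := hzero w
    simp only [hpw, ← Finset.sum_mul] at h1
    exact (mul_eq_zero.1 h1).resolve_right (by positivity)
  refine ⟨a, fun h0 => hi (by simp [h0]), ha0, fun j => ?_⟩
  simp [potential, hypChord, mul_sub, Finset.sum_sub_distrib, ha0, hzero]

lemma hyp_exists_extension {x z : Hyp n} {r : ℝ} (hr : 0 ≤ r) (hxz : x ≠ z) :
    ∃ y : Hyp n, hypDist y z ≤ r ∧ hypDist x z + r ≤ hypDist x y := by
  have hc := (cosh_hypDist x z).symm
  have ha0 : 0 < hypDist x z :=
    (hypDist_nonneg x z).lt_of_ne' fun h => hxz (hyp_ext_of_hypDist_eq_zero h)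
  set a := hypDist x z with ha
  have hS : 0 < Real.sinh a := Real.sinh_pos_iff.2 ha0
  have hsc := Real.cosh_sq a
  have hsc' := Real.cosh_sq r
  -- As on the sphere, `y = (sinh (a + r) z - sinh r x) / sinh a` prolongs the geodesic from `x` by
  -- `r` beyond `z`.
  set β := Real.sinh r / Real.sinh a with hβ
  have hβ' : β * Real.sinh a = Real.sinh r := div_mul_cancel₀ _ hS.ne'
  set α := Real.cosh r + β * Real.cosh a with hα
  set y : Euc (n + 1) := α • (z : Euc (n + 1)) - β • (x : Euc (n + 1)) with hy
  have hyz : lorentz y (z : Euc (n + 1)) = Real.cosh r := by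
    rw [hy, lorentz_sub_left, lorentz_smul_left, lorentz_smul_left, z.2.2, hc, hα]
    ring
  have hxy : lorentz (x : Euc (n + 1)) y = Real.cosh (a + r) := by
    rw [hy, lorentz_sub_right, lorentz_smul_right, lorentz_smul_right, x.2.2, hc,
      Real.cosh_add, ← hβ', hα]
    linear_combination β * hsc
  have hyy : lorentz y y = 1 := by
    nth_rw 2 [hy]
    rw [lorentz_sub_right, lorentz_smul_right, lorentz_smul_right, hyz, lorentz_comm, hxy,
      Real.cosh_add, ← hβ', hα]
    rw [← hβ'] at hsc'
    linear_combination hsc'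
  refine ⟨⟨y, one_le_of_lorentz_pos (y := z) hyy (hyz ▸ Real.cosh_pos r), hyy⟩, ?_, ?_⟩
  · rw [hypDist_le_iff hr]
    exact hyz.le
  · change a + r ≤ Real.arcosh (lorentz (x : Euc (n + 1)) y)
    rw [hxy, Real.arcosh_cosh (by linarith)]

/-- The Lorentz reflection in the hyperplane orthogonal to `u`. -/
noncomputable def lorentzReflection (u v : Euc (n + 1)) : Euc (n + 1) :=
  v - (2 * lorentz v u / lorentz u u) • u

lemma lorentz_lorentzReflection {u : Euc (n + 1)} (hu : lorentz u u ≠ 0) (v w : Euc (n + 1)) :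
    lorentz (lorentzReflection u v) (lorentzReflection u w) = lorentz v w := by
  simp only [lorentzReflection, lorentz_sub_left, lorentz_sub_right, lorentz_smul_left,
    lorentz_smul_right, lorentz_comm u]
  field_simp
  ring

lemma lorentzReflection_involutive {u : Euc (n + 1)} (hu : lorentz u u ≠ 0) (v : Euc (n + 1)) :
    lorentzReflection u (lorentzReflection u v) = v := by
  have h : lorentz (lorentzReflection u v) u = - lorentz v u := by
    simp only [lorentzReflection, lorentz_sub_left, lorentz_smul_left]
    field_simp
    ring
  rw [lorentzReflection, h, lorentzReflection]
  module

lemma hyp_exists_reflection {x y : Hyp n} (hxy : x ≠ y) : ∃ σ : Hyp n ≃ Hyp n,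
    (∀ a b, hypDist (σ a) (σ b) = hypDist a b) ∧ σ x = y ∧
      ∀ z, hypDist z x = hypDist z y → σ z = z := by
  set u : Euc (n + 1) := (x : Euc (n + 1)) - y with hu
  have hxu : 2 * lorentz (x : Euc (n + 1)) u = lorentz u u := by
    simp only [hu, lorentz_sub_left, lorentz_sub_right, x.2.2, y.2.2,
      lorentz_comm (y : Euc (n + 1)) x]
    ring
  have hu0 : lorentz u u ≠ 0 := fun h => hxy <| hyp_ext_of_lorentz_eq_one <| by
    rw [h, hu, lorentz_sub_right, x.2.2] at hxu
    linarith
  have hTx : lorentzReflection u x = y := by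
    rw [lorentzReflection, hxu, div_self hu0, one_smul, hu, sub_sub_cancel]
  -- The reflection keeps the upper sheet: the image of `v` pairs with `y`, the image of `x`, as `v`
  -- pairs with `x`.
  have hmem : ∀ v : Hyp n, 1 ≤ lorentzReflection u v 0 ∧
      lorentz (lorentzReflection u v) (lorentzReflection u v) = 1 := fun v => by
    have h1 := lorentz_lorentzReflection hu0 v v
    rw [v.2.2] at h1
    refine ⟨one_le_of_lorentz_pos (y := y) h1 ?_, h1⟩
    rw [← hTx, lorentz_lorentzReflection hu0]
    exact zero_lt_one.trans_le (one_le_lorentz_coe v x)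
  have hinv : Function.Involutive fun v : Hyp n => (⟨lorentzReflection u v, hmem v⟩ : Hyp n) :=
    fun v => Subtype.ext (lorentzReflection_involutive hu0 _)
  refine ⟨hinv.toPerm, fun a b => ?_, Subtype.ext hTx, fun z hz => Subtype.ext ?_⟩
  · change Real.arcosh (lorentz (lorentzReflection u a) (lorentzReflection u b)) = _
    rw [lorentz_lorentzReflection hu0, hypDist]
  · change lorentzReflection u z = z
    have h : lorentz (z : Euc (n + 1)) u = 0 := by
      rw [hu, lorentz_sub_right, ← cosh_hypDist, hz, cosh_hypDist, sub_self]
    rw [lorentzReflection, h, mul_zero, zero_div, zero_smul, sub_zero]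

lemma hypSegment_subset {z x y : Hyp n} {R : ℝ} (hx : hypDist x z ≤ R) (hy : hypDist y z ≤ R) :
    hypSegment x y ⊆ {q | hypDist q z ≤ R} := by
  rintro q ⟨u, t, s, -, -, hs, hst, hyu, hqu⟩
  have hR0 : 0 ≤ R := (hypDist_nonneg x z).trans hx
  rw [hypDist_le_iff hR0] at hx hy
  change hypDist q z ≤ R
  rw [hypDist_le_iff hR0]
  rcases (hs.trans hst).eq_or_lt with ht | ht
  · have hs0 : s = 0 := by linarith
    rw [hqu, hs0]
    simpa using hx
  · have hS : 0 < Real.sinh t := Real.sinh_pos_iff.2 ht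
    have hs1 : 0 ≤ Real.sinh s := Real.sinh_nonneg_iff.2 hs
    have hs2 : 0 ≤ Real.sinh (t - s) := Real.sinh_nonneg_iff.2 (by linarith)
    have key : Real.sinh t * lorentz (q : Euc (n + 1)) (z : Euc (n + 1))
        = Real.sinh (t - s) * lorentz (x : Euc (n + 1)) (z : Euc (n + 1))
          + Real.sinh s * lorentz (y : Euc (n + 1)) (z : Euc (n + 1)) := by
      rw [hqu, hyu]
      simp only [lorentz_add_left, lorentz_smul_left]
      rw [Real.sinh_sub]
      ring
    -- Opposite to the sine inequality on the sphere, as needed here, where balls are given by upper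
    -- bounds on the form.
    have hsum : Real.sinh (t - s) + Real.sinh s ≤ Real.sinh t := by
      have h1 : Real.sinh t
          = Real.sinh (t - s) * Real.cosh s + Real.cosh (t - s) * Real.sinh s := by
        rw [← Real.sinh_add, sub_add_cancel]
      rw [h1]
      exact add_le_add (le_mul_of_one_le_right hs2 (Real.one_le_cosh _))
        (le_mul_of_one_le_left hs1 (Real.one_le_cosh _))
    have h2 := mul_le_mul_of_nonneg_left hx hs2
    have h3 := mul_le_mul_of_nonneg_left hy hs1
    have h4 := mul_le_mul_of_nonneg_right hsum (Real.cosh_pos R).le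
    refine le_of_mul_le_mul_left ?_ hS
    rw [key]
    linarith

/-- A regular simplex of `ℝⁿ` centred at the origin. -/
lemma euc_exists_centred_simplex (hn : n ≠ 0) {L : ℝ} (hL : 0 < L) :
    ∃ (u : Fin (n + 1) → Euc n) (ρ : ℝ), 0 ≤ ρ ∧ (∀ i, ‖u i‖ ^ 2 = ρ) ∧
      ∀ i j, i ≠ j → ‖u i - u j‖ = L := by
  obtain ⟨v, hv⟩ := euc_exists_simplex hn hL
  set l : Fin (n + 1) → ℝ := fun _ => 1 / ((n : ℝ) + 1) with hl
  have hs := (const_mem_stdSimplex n).2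
  -- Equal potentials at the vertices make them equidistant from the barycentre, by the parallel
  -- axis formula.
  have hpot : ∀ j, potential eucChord l v (v j) = 1 / ((n : ℝ) + 1) * (n * L ^ 2) := fun j => by
    rw [potential, Fin.sum_univ_succAbove _ j]
    have h : ∀ i, l (j.succAbove i) * eucChord (v (j.succAbove i)) (v j)
        = 1 / ((n : ℝ) + 1) * L ^ 2 := fun i => by
      rw [eucChord, ← dist_eq_norm, hv _ _ (Fin.succAbove_ne j i)]
    rw [Finset.sum_congr rfl fun i _ => h i]
    simp [eucChord]
    ring
  refine ⟨fun i => v i - ∑ j, l j • v j, ‖v 0 - ∑ j, l j • v j‖ ^ 2, sq_nonneg _, fun i => ?_,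
    fun i j hij => ?_⟩
  · have h1 := potential_eucChord hs v (v i)
    have h2 := potential_eucChord hs v (v 0)
    rw [hpot] at h1 h2
    rw [eucChord, norm_sub_rev] at h1 h2
    linarith
  · rw [sub_sub_sub_cancel_right, ← dist_eq_norm, hv i j hij]

/-- Lift a centred Euclidean simplex to height `√(1 + ρ)`. The form between two lifts is `1 + ‖u i -
u j‖² / 2`, which dictates the edge length `√(2 (cosh D - 1))`. -/
lemma hyp_exists_simplex (hn : n ≠ 0) {D : ℝ} (hD : 0 < D) :
    ∃ v : Fin (n + 1) → Hyp n, ∀ i j, i ≠ j → hypDist (v i) (v j) = D := by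
  have hc : 1 < Real.cosh D := Real.one_lt_cosh.2 hD.ne'
  obtain ⟨u, ρ, hρ, hu, huu⟩ := euc_exists_centred_simplex hn
    (L := √(2 * (Real.cosh D - 1))) (Real.sqrt_pos.2 (by linarith))
  set v : Fin (n + 1) → Euc (n + 1) := fun i =>
    WithLp.toLp 2 (Fin.cons √(1 + ρ) (u i) : Fin (n + 1) → ℝ) with hv
  have hB : ∀ i j, lorentz (v i) (v j) = 1 + ρ - inner ℝ (u i) (u j) := fun i j => by
    rw [lorentz, PiLp.inner_apply]
    simp only [hv, Fin.cons_zero, Fin.cons_succ, RCLike.inner_apply, conj_trivial,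
      mul_comm (u j _)]
    rw [Real.mul_self_sqrt (by linarith)]
  refine ⟨fun i => ⟨v i, Real.one_le_sqrt.2 (by linarith), ?_⟩, fun i j hij => ?_⟩
  · rw [hB, real_inner_self_eq_norm_sq, hu, add_sub_cancel_right]
  · change Real.arcosh (lorentz (v i) (v j)) = D
    have h : lorentz (v i) (v j) = Real.cosh D := by
      have h1 : ‖u i - u j‖ ^ 2 = 2 * (Real.cosh D - 1) := by
        rw [huu i j hij, Real.sq_sqrt (by linarith)]
      rw [norm_sub_sq_real, hu, hu] at h1
      rw [hB]
      linarith
    rw [h, Real.arcosh_cosh hD.le]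

instance : TopologicalSpace (Space .hyperbolic n) := inferInstanceAs (TopologicalSpace (Hyp n))

lemma jungSpace_hyperbolic (hn : n ≠ 0) {D : ℝ} (hD : 0 < D) :
    JungSpace .hyperbolic n D (Real.cosh D - 1) (hypChord (n := n))
      (fun e => Real.arcosh √(1 + e)) := by
  have hcont : Continuous fun q : Hyp n × Hyp n => hypChord q.1 q.2 :=
    (continuous_lorentz.comp (by fun_prop : Continuous fun q : Hyp n × Hyp n =>
      ((q.1 : Euc (n + 1)), (q.2 : Euc (n + 1))))).sub continuous_const
  have hcomm : ∀ x y : Hyp n, hypChord x y = hypChord y x := fun x y => by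
    rw [hypChord, lorentz_comm, hypChord]
  have hself : ∀ x : Hyp n, hypChord x x = 0 := fun x => by rw [hypChord, x.2.2, sub_self]
  have hle : ∀ x y : Hyp n, hypChord x y ≤ Real.cosh D - 1 ↔ hypDist x y ≤ D := fun x y => by
    rw [hypDist_le_iff hD.le, hypChord, sub_le_sub_iff_right]
  have heq : ∀ x y : Hyp n, hypChord x y = Real.cosh D - 1 → hypDist x y = D := fun x y h => by
    rw [hypChord, sub_left_inj] at h
    rw [hypDist, h, Real.arcosh_cosh hD.le]
  have heq' : ∀ x y : Hyp n, hypDist x y = D → hypChord x y = Real.cosh D - 1 := fun x y h => by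
    rw [hypChord, ← cosh_hypDist, h]
  have hball : ∀ z : Hyp n, IsCompact {x : Hyp n | hypDist x z ≤ D} := fun z => by
    simp only [hypDist_le_iff hD.le]
    exact hyp_isCompact_ball z _
  exact
  { D_pos := hD
    H_pos := sub_pos.2 (Real.one_lt_cosh.2 hD.ne')
    dist_self := hypDist_self (n := n)
    dist_comm := hypDist_comm (n := n)
    dist_triangle := hypDist_triangle (n := n)
    continuous_chord := hcont
    chord_comm := hcomm
    chord_self := hself
    chord_nonneg := hypChord_nonneg (n := n)
    chord_le_iff := hle
    dist_eq_of_chord_eq := heq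
    chord_eq_of_dist_eq := heq'
    isCompact_ball := hball
    rad_nonneg := fun e he => Real.arcosh_nonneg (Real.one_le_sqrt.2 (by linarith))
    rad_strictMono := fun a ha b hb hab =>
      (Real.arcosh_lt_arcosh (Real.sqrt_pos.2 (by linarith [ha.1]))
        (Real.sqrt_pos.2 (by linarith [hb.1]))).2
        (Real.sqrt_lt_sqrt (by linarith [ha.1]) (by linarith))
    exists_center := fun m l p hl _ => hyp_exists_center hl p
    rad_le := fun m l p hl _ z R h => hyp_rad_le hl p z R h
    exists_dependence := fun l p hl _ h => hyp_exists_dependence hl p h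
    exists_extension := fun x z r hr _ hxz _ => hyp_exists_extension hr hxz
    exists_reflection := fun x y hxy => hyp_exists_reflection hxy
    hemisphereCondition := fun _ _ _ => trivial
    geodSegment_subset := fun z R _ x hx y hy => hypSegment_subset hx hy
    exists_simplex := hyp_exists_simplex hn hD }

end Hyperbolic

end ConstCurv

theorem corollary4p6 (k : Kind) (n : ℕ) (hn : 2 ≤ n) (D : ℝ) (hD : 0 < D)
    (hDS : k = Kind.spherical → D < Real.pi / 2)
    (K : Set (Space k n)) (hK : DiamComplete K) (hKD : diam K = D) :
    IsLeast (outerRadii K) (circumradius K) ∧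
    IsGreatest (innerRadii K) (inradius K) ∧
    (∃ S : Set (Space k n), IsRegularSimplex D S) ∧
    ∀ S : Set (Space k n), IsRegularSimplex D S →
      IsLeast (outerRadii S) (circumradius S) ∧
      circumradius K ≤ circumradius S ∧
      D - circumradius S ≤ inradius K ∧
      (circumradius K = circumradius S ↔ ContainsCongruentCopy K S) ∧
      (inradius K = D - circumradius S ↔ ContainsCongruentCopy K S) := by
  have hn0 : n ≠ 0 := by omega
  cases k with
  | euclidean => exact (jungSpace_euclidean hn0 hD).complete_radii hK hKD
  | spherical => exact (jungSpace_spherical hD (hDS rfl)).complete_radii hK hKD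
  | hyperbolic => exact (jungSpace_hyperbolic hn0 hD).complete_radii hK hKD
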